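/- **Setting.** Let $\chi(x,y)=p_0(x)+p_1(x)y+\dots+p_{n-1}(x)y^{n-1}+y^n\in\mathbb C[x,y]$ be irreducible over $\mathbb C$, monic of degree $n$ in $y$, with nonzero constant term $\chi(0,0)\neq 0$; write $\chi'=\partial\chi/\partial y$. Let $P\subset\mathbb R^2$ be its Newton polygon, i.e. the convex hull of the exponent vectors $(a,m)$ of the nonzero terms $x^ay^m$ of $\chi$. Let $y^{(1)},\dots,y^{(n)}$ be the roots of $\chi(x,y)=0$ in the Puiseux series in $1/x$ over $\mathbb C$. Let $h_\ell$ be the highest exponent of $x$ occurring in $y^{(\ell)}$, order the roots so that $h_1\ge\dots\ge h_n$, and assume that the highest terms $c_\ell x^{h_\ell}$ ($c_\ell\ne0$) of the $y^{(\ell)}$ are pairwise distinct. Let $\Omega$ be the complex vector space of the differential forms $f(x,y)\,dx=\dfrac{f_1(x,y)}{\chi'(y)}\,dx$ (rational differentials of the function field of the curve $\chi=0$), where $f_1=\sum c_{a,m}x^ay^m$, $c_{a,m}\in\mathbb C$, the sum being over the pairs $(a,m)$ for which $(a+1,m+1)$ is an interior lattice point of $P$. For $0\le m\le n-2$ let $\tau_m$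 be the largest integer such that $(\tau_m+1,m+1)$ is an interior lattice point of $P$, and $\tau_m=-1$ if there is no such point. Let $\theta(x,y,\underline a)=q_0+q_1y+\dots+q_{n-1}y^{n-1}$ be a polynomial in $y$ of degree less than $n$ whose coefficients $q_i$ are polynomials in $x$ and in independent indeterminates $\underline a=(a_1,\dots,a_s)$ over $\mathbb C$. Write $r(x,\underline a)=\mathrm{Res}_y(\chi,\theta)=F_0(x)F(x,\underline a)$, where no root of $F$ (as a polynomial in $x$) is algebraic over $\mathbb C$. Assume that $F_0$ is a nonzero constant and that $F$ and $\partial F/\partial x$ have no common factor in $\mathbb C(\underline a)[x]$. Let $(x_i,y_i)$, $i=1,\dots,\mu$, be the solutions of $\chi(x,y)=\theta(x,y,\underline a)=0$ in the algebraic closure of $\mathbb C(\underline a)$ with $dx_i\ne0$. **Proposition.** 1. For every $\theta$ as above there are finitely many such solutions, $\chi'(x_i,y_i)\ne0$ for all of them, and for every $f\,dx\in\Omega$ the sum $v=\sum_{i=1}^{\mu}\int f(x_i,y_i)\,dx_i$ is constant. That is, $dv=\sum_{i=1}^\mu f(x_i,y_i)\,dx_i=0$; and whenever $v_i$ are antiderivatives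 of the $f(x_i,y_i)\,dx_i$ (with respect to all $\partial/\partial a_j$) in some differential field extension of $\overline{\mathbb C(\underline a)}$, the sum $v=\sum_i v_i$ satisfies $\partial v/\partial a_j=0$ for all $j$. 2. $\tau_m=\lceil h_1+\dots+h_{n-m-1}\rceil-2$ for $0\le m\le n-2$. 3. $P$ has finitely many interior lattice points, $\Omega$ is finite-dimensional, and $$\dim\Omega=\#\{\text{interior lattice points of }P\}=\sum_{m=0}^{n-2}(\tau_m+1).$$ -/

import Mathlib

open Polynomial

noncomputable section

namespace AbelNewton

/-! Polynomials in `x, y` are elements of `ℂ[X][X]`: the inner variable is `x`, the outer one `y`.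
So `(χ.coeff m).coeff a` is the coefficient of `x ^ a * y ^ m`. -/

/-! ### Newton polygon -/

/-- The Newton polygon: convex hull of the exponent vectors `(a, m)` of the nonzero terms
`x ^ a * y ^ m` of `χ`. -/
def newtonPolygon (χ : ℂ[X][X]) : Set (ℝ × ℝ) :=
  convexHull ℝ {p | ∃ a m : ℕ, (χ.coeff m).coeff a ≠ 0 ∧ p = ((a : ℝ), (m : ℝ))}

/-- The lattice points in the interior of the Newton polygon. -/
def interiorPoints (χ : ℂ[X][X]) : Set (ℤ × ℤ) :=
  {p | ((p.1 : ℝ), (p.2 : ℝ)) ∈ interior (newtonPolygon χ)}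

/-- The integers `t` such that `(t + 1, m + 1)` is an interior lattice point. -/
def tauSet (χ : ℂ[X][X]) (m : ℕ) : Set ℤ :=
  {t | (t + 1, (m : ℤ) + 1) ∈ interiorPoints χ}

open Classical in
/-- `τ_m`: the largest `t` such that `(t + 1, m + 1)` is an interior lattice point, and `-1` when
there is no such point. -/
def tau (χ : ℂ[X][X]) (m : ℕ) : ℤ :=
  if (tauSet χ m).Nonempty then sSup (tauSet χ m) else -1

/-! ### Puiseux series in `1 / x`

They are written as series in `u = 1 / x` with rational exponents, so that `x = u ^ (-1)`. -/

/-- A series in `u` with rational exponents is a Puiseux series if its exponents have a common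
denominator (well-ordered support then leaves finitely many negative exponents). -/
def IsPuiseux (f : HahnSeries ℚ ℂ) : Prop :=
  ∃ N : ℕ, 0 < N ∧ ∀ q ∈ f.support, ∃ k : ℤ, q = (k : ℚ) / (N : ℚ)

/-- A polynomial in `x`, seen as a series in `u = 1 / x`. -/
def toSeries : ℂ[X] →+* HahnSeries ℚ ℂ :=
  (aeval (HahnSeries.single (-1 : ℚ) (1 : ℂ)) : ℂ[X] →ₐ[ℂ] HahnSeries ℚ ℂ).toRingHom

/-- `h(R)`: the highest exponent of `x` in `R`, i.e. minus the lowest exponent of `u = 1 / x`. -/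
def highestExponent (R : HahnSeries ℚ ℂ) : ℚ := -R.order

/-- The highest term `c * x ^ h` of `R`. -/
def highestTerm (R : HahnSeries ℚ ℂ) : HahnSeries ℚ ℂ :=
  HahnSeries.single R.order R.leadingCoeff

/-! ### The space of differentials -/

/-- The polynomials `f₁ = ∑ c_{a,m} x ^ a y ^ m`, the sum being over pairs `(a, m)` such that
`(a + 1, m + 1)` is an interior lattice point of the Newton polygon of `χ`. -/
def numerators (χ : ℂ[X][X]) : Submodule ℂ ℂ[X][X] where
  carrier := {g | ∀ a m : ℕ, (g.coeff m).coeff a ≠ 0 →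
    ((a : ℤ) + 1, (m : ℤ) + 1) ∈ interiorPoints χ}
  zero_mem' := by
    intro a m h
    simp at h
  add_mem' := by
    intro f g hf hg a m h
    by_cases h1 : (f.coeff m).coeff a = 0
    · refine hg a m fun h2 => h ?_
      simp [h1, h2]
    · exact hf a m h1
  smul_mem' := by
    intro c f hf a m h
    refine hf a m fun h1 => h ?_
    simp [h1]

instance instIsDomainAdjoinRoot (χ : ℂ[X][X]) [hχ : Fact (Irreducible χ)] :
    IsDomain (AdjoinRoot χ) :=
  AdjoinRoot.isDomain_of_prime hχ.out.prime

/-- The function field of the curve `χ(x, y) = 0`. -/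
abbrev FunctionField (χ : ℂ[X][X]) : Type := FractionRing (AdjoinRoot χ)

/-- The coordinate function `x`. -/
def coordX (χ : ℂ[X][X]) : FunctionField χ :=
  algebraMap (AdjoinRoot χ) (FunctionField χ) (AdjoinRoot.of χ X)

/-- The coordinate function `y`. -/
def coordY (χ : ℂ[X][X]) : FunctionField χ :=
  algebraMap (AdjoinRoot χ) (FunctionField χ) (AdjoinRoot.root χ)

/-- The value at `(x, y)` of the rational function `f = g / χ'`, where `χ' = ∂χ/∂y`. -/
def ratValue {A : Type*} [Field A] [Algebra ℂ A] (χ g : ℂ[X][X]) (x y : A) : A :=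
  aevalAeval x y g / aevalAeval x y (derivative χ)

/-- The space `Ω` of the differential forms `(f₁(x, y) / χ'(y)) dx`, inside the Kähler
differentials of the function field over `ℂ`. -/
def differentials (χ : ℂ[X][X]) [Fact (Irreducible χ)] :
    Submodule ℂ (KaehlerDifferential ℂ (FunctionField χ)) where
  carrier := {ω | ∃ g ∈ numerators χ,
    ω = ratValue χ g (coordX χ) (coordY χ) • KaehlerDifferential.D ℂ (FunctionField χ) (coordX χ)}
  zero_mem' := ⟨0, Submodule.zero_mem _, by simp [ratValue]⟩
  add_mem' := by
    rintro _ _ ⟨f, hf, rfl⟩ ⟨g, hg, rfl⟩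
    exact ⟨f + g, Submodule.add_mem _ hf hg, by simp [ratValue, add_div, add_smul]⟩
  smul_mem' := by
    rintro c _ ⟨f, hf, rfl⟩
    refine ⟨c • f, Submodule.smul_mem _ c hf, ?_⟩
    simp only [ratValue, map_smul, smul_div_assoc, smul_assoc]

/-! ### Abel's sums

The indeterminates `a₁, …, a_s` generate `ℂ[a]`; algebraic functions of them are the elements of an
algebraic closure of `ℂ(a)`. -/

/-- Polynomials in the indeterminates `a₁, …, a_s`. -/
abbrev Params (s : ℕ) : Type := MvPolynomial (Fin s) ℂ

/-- The field of rational functions in the indeterminates `a₁, …, a_s`. -/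
abbrev ParamField (s : ℕ) : Type := FractionRing (Params s)

/-- The field of algebraic functions of `a₁, …, a_s`. -/
abbrev AlgFun (s : ℕ) : Type := AlgebraicClosure (ParamField s)

/-- The indeterminate `a_j`, as an algebraic function. -/
def param (s : ℕ) (j : Fin s) : AlgFun s := algebraMap (Params s) (AlgFun s) (MvPolynomial.X j)

/-- The solutions `(x_i, y_i)` of `χ(x, y) = θ(x, y, a) = 0` for which `dx_i ≠ 0`. -/
def movingSolutions {s : ℕ} (χ : ℂ[X][X]) (θ : (Params s)[X][X]) : Set (AlgFun s × AlgFun s) :=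
  {p | aevalAeval p.1 p.2 χ = 0 ∧ aevalAeval p.1 p.2 θ = 0 ∧
    KaehlerDifferential.D ℂ (AlgFun s) p.1 ≠ 0}

/-- `r(x, a)`: the resultant of `χ` and `θ` with respect to `y`. -/
def elim {s : ℕ} (χ : ℂ[X][X]) (θ : (Params s)[X][X]) : (Params s)[X] :=
  resultant (χ.map (mapRingHom MvPolynomial.C)) θ

/-- `r(x, a) = F₀(x) F(x, a)`, where `F` has no root that is algebraic over `ℂ`, i.e. no root
in `ℂ`. (All roots of `F₀` lie in `ℂ`.) -/
structure IsRootSplitting {s : ℕ} (r : (Params s)[X]) (F₀ : ℂ[X]) (F : (Params s)[X]) : Prop where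
  eq_mul : r = F₀.map MvPolynomial.C * F
  eval_ne_zero : ∀ c : ℂ, F.eval (MvPolynomial.C c) ≠ 0

/-- `dv = ∑ f(x_i, y_i) dx_i` for `f = g / χ'`; the sum is over the solutions with `dx_i ≠ 0`. -/
def dv {s : ℕ} (χ : ℂ[X][X]) (θ : (Params s)[X][X]) (g : ℂ[X][X]) :
    KaehlerDifferential ℂ (AlgFun s) :=
  ∑ᶠ p ∈ movingSolutions χ θ,
    ratValue χ g p.1 p.2 • KaehlerDifferential.D ℂ (AlgFun s) p.1

/-- Commuting derivations `∂/∂a_j` on an extension `E` of the field of algebraic functions, making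
`E` a differential field extension of it: since `∂a_k/∂a_j = δ_{jk}`, they restrict to the usual
derivations of `AlgFun s`. -/
structure PartialDerivatives (s : ℕ) (E : Type*) [Field E] [Algebra ℂ E] [Algebra (AlgFun s) E] where
  partials : Fin s → Derivation ℂ E E
  partials_param : ∀ j k, partials j (algebraMap (AlgFun s) E (param s k)) = if j = k then 1 else 0
  partials_comm : ∀ j k w, partials j (partials k w) = partials k (partials j w)

/-- `v i` is an antiderivative `∫ f(x_i, y_i) dx_i`, `f = g / χ'`, for each of the solutions
`i = (x_i, y_i)` with `dx_i ≠ 0`. -/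
def AreIntegrals {s : ℕ} {E : Type*} [Field E] [Algebra ℂ E] [Algebra (AlgFun s) E]
    (D : PartialDerivatives s E) (χ : ℂ[X][X]) (θ : (Params s)[X][X]) (g : ℂ[X][X])
    (v : AlgFun s × AlgFun s → E) : Prop :=
  ∀ p ∈ movingSolutions χ θ, ∀ j,
    D.partials j (v p) =
      algebraMap (AlgFun s) E (ratValue χ g p.1 p.2) *
        D.partials j (algebraMap (AlgFun s) E p.1)

end AbelNewton

end

/-!
Two facts about the branches `y l` carry the proof.

*Newton polygon.* The coefficient of `y ^ m` in `∏ (Y - y l)` is an elementary symmetric function,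
so for each slope `h` all exponents satisfy `a + m h ≤ ∑ max (h_l, h)` (`exponent_le`). If the
`h_l` exceeding a slope are `k` in number, one product of `k` roots strictly dominates the other
ones, so that `(h_1 + ⋯ + h_k, n - k)` is a point of the polygon
(`mem_newtonPolygon_of_dominant`). Since the `h_l` decrease, the right boundary at height `M` is
`h_1 + ⋯ + h_{n - M}`, and interior points are described by `mem_interiorPoints_iff`. These partial
sums are positive for `0 < M < n`, because a polynomial in `y` alone is reducible; this is what
makes `⌈·⌉ - 2` equal to `-1` for an empty row. The dimension of the space of differentials follows
as `x` is a separating element of the function field (`D_coordX_ne_zero`).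

*Abel's theorem.* Let `δ` be a derivation of the algebraic functions of the parameters, extended
to polynomials through their coefficients, and write the resultant as `r = a χ + b θ`. At a common
zero `(x, y)` of `χ` and `θ` one gets `b δθ = - r' δx`, whereas `b = 0` at the other points above a
root `x` of `r`. Hence `- ∑ (g / χ') δx` is the sum over the roots of `r` of `R / r'`, where
`R = ∑ g δθ b / χ'`, summed over the roots `y` of `χ`, is a polynomial in `x` by Euler's formula
(`coeff_modByMonic_prod`). That sum vanishes if `deg R ≤ deg r - 2` (`natDegree_eulerTrace_lt`), an
estimate made in series in `u = 1 / x` over the field of algebraic functions, where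
`R / r = ∑ (g / χ') (δθ / θ)`: as the branches have constant coefficients, `δθ / θ` has nonnegative
order, and the order of `g / χ'` exceeds `1` by the distinctness of the highest terms and the
interior point condition (`one_add_order_lt`). Testing against all derivations gives `dv = 0`.
-/

namespace AbelNewton

/-! ### Polynomials in `x` as series in `u = 1 / x` -/

section Series

variable {K : Type*} [Field K]

/-- The value of a polynomial at `x = u⁻¹` in the field of series in `u`. -/
noncomputable def polySeries : K[X] →+* HahnSeries ℚ K :=
  eval₂RingHom HahnSeries.C (HahnSeries.single (-1 : ℚ) (1 : K))

lemma toSeries_eq_polySeries : toSeries = polySeries := by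
  refine ringHom_ext (fun c => ?_) ?_
  · simp only [toSeries, AlgHom.toRingHom_eq_coe, RingHom.coe_coe, aeval_C, polySeries,
      coe_eval₂RingHom, eval₂_C, HahnSeries.algebraMap_apply', MvPowerSeries.algebraMap_apply,
      Algebra.algebraMap_self, RingHom.id_apply]
    exact HahnSeries.ofPowerSeries_C c
  · simp [toSeries, polySeries]

lemma single_neg_one_pow (k : ℕ) :
    (HahnSeries.single (-1 : ℚ) (1 : K)) ^ k = HahnSeries.single (-(k : ℚ)) 1 := by
  simp [HahnSeries.single_pow]

lemma coeff_polySeries (p : K[X]) (q : ℚ) :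
    (polySeries p).coeff q = ∑ k ∈ Finset.range (p.natDegree + 1),
      if q = -(k : ℚ) then p.coeff k else 0 := by
  rw [polySeries, coe_eval₂RingHom, eval₂_eq_sum_range, HahnSeries.coeff_sum]
  refine Finset.sum_congr rfl fun k _ => ?_
  rw [single_neg_one_pow, HahnSeries.C_mul_eq_smul,
    HahnSeries.coeff_smul, HahnSeries.coeff_single]
  split_ifs <;> simp

lemma coeff_polySeries_neg_natCast (p : K[X]) (k : ℕ) :
    (polySeries p).coeff (-(k : ℚ)) = p.coeff k := by
  rw [coeff_polySeries]
  simp only [neg_inj, Nat.cast_inj, Finset.sum_ite_eq, Finset.mem_range]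
  split_ifs with h
  · rfl
  · exact (coeff_eq_zero_of_natDegree_lt (by omega)).symm

lemma orderTop_polySeries {p : K[X]} (hp : p ≠ 0) :
    (polySeries p).orderTop = ((-(p.natDegree : ℚ) : ℚ) : WithTop ℚ) := by
  refine HahnSeries.orderTop_eq_of_le ?_ fun q hq => ?_
  · rw [HahnSeries.mem_support, coeff_polySeries_neg_natCast]
    exact leadingCoeff_ne_zero.mpr hp
  · rw [HahnSeries.mem_support, coeff_polySeries] at hq
    obtain ⟨k, hk, h⟩ := Finset.exists_ne_zero_of_sum_ne_zero hq
    have : q = -(k : ℚ) := by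
      by_contra h'
      simp [h'] at h
    rw [this, neg_le_neg_iff, Nat.cast_le]
    exact Nat.lt_succ_iff.mp (Finset.mem_range.mp hk)

lemma polySeries_injective : Function.Injective (polySeries : K[X] → HahnSeries ℚ K) := by
  rw [injective_iff_map_eq_zero]
  intro p hp
  ext k
  rw [← coeff_polySeries_neg_natCast, hp]
  simp

lemma addVal_polySeries {p : K[X]} (hp : p ≠ 0) :
    HahnSeries.addVal ℚ K (polySeries p) = ((-(p.natDegree : ℚ) : ℚ) : WithTop ℚ) := by
  rw [HahnSeries.addVal_apply, orderTop_polySeries hp]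

/-! ### The valuations of the coefficients of a product of linear factors -/

variable {ι : Type*} (y : ι → HahnSeries ℚ K)

/-- The Gauss valuation of slope `h` of a product of linear factors is bounded by the sum of the
Gauss valuations of the factors. -/
lemma le_addVal_coeff_prod (hy : ∀ l, y l ≠ 0) (h : ℚ) (s : Finset ι) (m : ℕ) :
    ((m * h - ∑ l ∈ s, max (-(y l).order) h : ℚ) : WithTop ℚ) ≤
      HahnSeries.addVal ℚ K ((∏ l ∈ s, (X - C (y l))).coeff m) := by
  classical
  induction s using Finset.induction_on generalizing m with
  | empty =>
    rcases Nat.eq_zero_or_pos m with rfl | hm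
    · simp
    · simp [coeff_one, hm.ne']
  | insert l s hl ih =>
    rw [Finset.prod_insert hl, Finset.sum_insert hl, mul_comm (X - C (y l))]
    have hroot : ∀ k : ℕ, ((k * h - (max (-(y l).order) h + ∑ l ∈ s, max (-(y l).order) h) : ℚ) :
        WithTop ℚ) ≤ HahnSeries.addVal ℚ K ((∏ l ∈ s, (X - C (y l))).coeff k * y l) := by
      intro k
      rw [AddValuation.map_mul, HahnSeries.addVal_apply_of_ne (hy l)]
      refine le_trans ?_ (add_le_add_left (ih k) _)
      rw [← WithTop.coe_add, WithTop.coe_le_coe]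
      linarith [le_max_left (-(y l).order) h]
    cases m with
    | zero =>
      have := hroot 0
      rw [mul_coeff_zero]
      simpa using this
    | succ k =>
      rw [coeff_mul_X_sub_C]
      refine AddValuation.map_le_sub _ ?_ (hroot (k + 1))
      refine le_trans ?_ (ih k)
      rw [WithTop.coe_le_coe]
      push_cast
      linarith [le_max_right (-(y l).order) h]

lemma addVal_prod (hy : ∀ l, y l ≠ 0) (s : Finset ι) :
    HahnSeries.addVal ℚ K (∏ l ∈ s, y l) = ((∑ l ∈ s, (y l).order : ℚ) : WithTop ℚ) := by
  classical
  induction s using Finset.induction_on with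
  | empty => simp
  | insert l s hl ih =>
    rw [Finset.prod_insert hl, Finset.sum_insert hl, AddValuation.map_mul, ih,
      HahnSeries.addVal_apply_of_ne (hy l), WithTop.coe_add]

/-- When one product of `#T` roots strictly dominates all others, it determines the valuation of
the corresponding elementary symmetric function. -/
lemma addVal_coeff_prod_of_dominant [Fintype ι] (hy : ∀ l, y l ≠ 0) (T : Finset ι)
    (hT : ∀ S : Finset ι, S.card = T.card → S ≠ T →
      ∑ l ∈ T, (y l).order < ∑ l ∈ S, (y l).order) :
    HahnSeries.addVal ℚ K ((∏ l, (X - C (y l))).coeff (Fintype.card ι - T.card)) =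
      ((∑ l ∈ T, (y l).order : ℚ) : WithTop ℚ) := by
  classical
  have hval : ∀ S : Finset ι, HahnSeries.addVal ℚ K (∏ l ∈ S, -y l) =
      ((∑ l ∈ S, (y l).order : ℚ) : WithTop ℚ) := by
    intro S
    simpa using addVal_prod (fun l => -y l) (fun l => neg_ne_zero.mpr (hy l)) S
  have hcard : T.card ≤ Fintype.card ι := Finset.card_le_univ T
  simp_rw [sub_eq_add_neg, ← C_neg]
  rw [Finset.prod_X_add_C_coeff _ _ (by simp), Finset.card_univ, Nat.sub_sub_self hcard,
    ← Finset.add_sum_erase _ _ (Finset.mem_powersetCard.mpr ⟨Finset.subset_univ T, rfl⟩),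
    AddValuation.map_add_eq_of_lt_left, hval]
  rw [hval]
  refine AddValuation.map_lt_sum _ WithTop.coe_ne_top fun S hS => ?_
  rw [Finset.mem_erase, Finset.mem_powersetCard] at hS
  rw [hval, WithTop.coe_lt_coe]
  exact hT S hS.2.2 hS.1

/-- The roots exceeding a slope, and the roots at least equal to it, dominate the products of the
same length. -/
lemma sum_lt_sum_of_slope {c : ι → ℚ} (h : ℚ) (S T : Finset ι)
    (hT : (∀ l, l ∈ T ↔ h < c l) ∨ (∀ l, l ∈ T ↔ h ≤ c l)) (hcard : S.card = T.card)
    (hne : S ≠ T) : ∑ l ∈ S, c l < ∑ l ∈ T, c l := by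
  classical
  have key : ∑ l ∈ S, (c l - h) < ∑ l ∈ T, (c l - h) := by
    rw [← Finset.sum_inter_add_sum_sdiff S T, ← Finset.sum_inter_add_sum_sdiff T S,
      Finset.inter_comm T S]
    have hc : (S \ T).card = (T \ S).card := by
      have h1 := Finset.card_sdiff_add_card_inter S T
      have h2 := Finset.card_sdiff_add_card_inter T S
      rw [Finset.inter_comm T S] at h2
      omega
    have hST : (S \ T).Nonempty := by
      rw [Finset.nonempty_iff_ne_empty]
      intro h0
      rw [Finset.sdiff_eq_empty_iff_subset] at h0
      exact hne (Finset.eq_of_subset_of_card_le h0 hcard.ge)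
    have hTS : (T \ S).Nonempty := by
      rw [← Finset.card_pos, ← hc, Finset.card_pos]
      exact hST
    rcases hT with hT | hT
    · have h1 : ∑ l ∈ S \ T, (c l - h) ≤ 0 := Finset.sum_nonpos fun l hl => by
        have := (hT l).not.mp (Finset.mem_sdiff.mp hl).2
        linarith
      have h2 : 0 < ∑ l ∈ T \ S, (c l - h) := Finset.sum_pos (fun l hl => by
        have := (hT l).mp (Finset.mem_sdiff.mp hl).1
        linarith) hTS
      linarith
    · have h1 : ∑ l ∈ S \ T, (c l - h) < 0 := Finset.sum_neg (fun l hl => by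
        have := (hT l).not.mp (Finset.mem_sdiff.mp hl).2
        linarith) hST
      have h2 : 0 ≤ ∑ l ∈ T \ S, (c l - h) := Finset.sum_nonneg fun l hl => by
        have := (hT l).mp (Finset.mem_sdiff.mp hl).1
        linarith
      linarith
  simp only [Finset.sum_sub_distrib, Finset.sum_const, hcard] at key
  linarith

end Series

/-! ### Partial sums of a decreasing sequence of slopes -/

section Slopes

variable {n : ℕ} (c : Fin n → ℚ)

/-- The sum of the first `k` terms of the sequence `c`. -/
def partialSum (k : ℕ) : ℚ := ∑ l ∈ Finset.univ.filter (fun l : Fin n => (l : ℕ) < k), c l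

lemma card_filter_lt {k : ℕ} (hk : k ≤ n) :
    (Finset.univ.filter (fun l : Fin n => (l : ℕ) < k)).card = k := by
  rw [Fin.card_filter_val_lt, min_eq_right hk]

variable {c}

lemma sum_max_eq (hc : Antitone c) {k : ℕ} (hk : k < n) :
    ∑ l, max (c l) (c ⟨k, hk⟩) = partialSum c (k + 1) + (n - (k + 1) : ℚ) * c ⟨k, hk⟩ := by
  have h : ∀ l : Fin n, max (c l) (c ⟨k, hk⟩) - c ⟨k, hk⟩ =
      if (l : ℕ) < k + 1 then c l - c ⟨k, hk⟩ else 0 := by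
    intro l
    split_ifs with hl
    · rw [max_eq_left (hc (Fin.mk_le_mk.mpr (Nat.lt_succ_iff.mp hl) : l ≤ ⟨k, hk⟩))]
    · rw [max_eq_right (hc (show (⟨k, hk⟩ : Fin n) ≤ l from Fin.mk_le_mk.mpr (by omega))), sub_self]
  have h2 := Finset.sum_congr (rfl : (Finset.univ : Finset (Fin n)) = Finset.univ) fun l _ => h l
  rw [← Finset.sum_filter, Finset.sum_sub_distrib, Finset.sum_sub_distrib, Finset.sum_const,
    Finset.sum_const, card_filter_lt (by omega), Finset.card_univ, Fintype.card_fin, nsmul_eq_mul,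
    nsmul_eq_mul] at h2
  push_cast at h2
  rw [partialSum]
  linarith

/-- Adding to the terms exceeding `c k` some of those equal to it moves the partial sum along a
line of slope `c k`. -/
lemma partialSum_add_mul (hc : Antitone c) {k : ℕ} (hk : k < n)
    {A : Finset (Fin n)} (h0 : ∀ l, c ⟨k, hk⟩ < c l → l ∈ A) (h1 : ∀ l ∈ A, c ⟨k, hk⟩ ≤ c l) :
    ∑ l ∈ A, c l = partialSum c (k + 1) + ((A.card : ℚ) - (k + 1)) * c ⟨k, hk⟩ := by
  -- all such sets have the same sum of `c l - c k`
  have key : ∀ B : Finset (Fin n), (∀ l, c ⟨k, hk⟩ < c l → l ∈ B) → (∀ l ∈ B, c ⟨k, hk⟩ ≤ c l) →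
      ∑ l ∈ B, c l - B.card * c ⟨k, hk⟩ = ∑ l, max (c l - c ⟨k, hk⟩) 0 := by
    intro B h0 h1
    rw [← nsmul_eq_mul, ← Finset.sum_const, ← Finset.sum_sub_distrib]
    rw [← Finset.sum_subset (Finset.subset_univ B)]
    · exact Finset.sum_congr rfl fun l hl => (max_eq_left (sub_nonneg.mpr (h1 l hl))).symm
    · intro l _ hl
      exact max_eq_right (sub_nonpos.mpr (not_lt.mp fun h => hl (h0 l h)))
  have hA := key A h0 h1
  have hK := key (Finset.univ.filter fun l : Fin n => (l : ℕ) < k + 1)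
    (fun l hl => Finset.mem_filter.mpr ⟨Finset.mem_univ _, by
      by_contra h
      exact absurd (hc (show (⟨k, hk⟩ : Fin n) ≤ l from Fin.mk_le_mk.mpr (by omega)))
        (not_le.mpr hl)⟩)
    (fun l hl => hc (show l ≤ (⟨k, hk⟩ : Fin n) from
      Fin.mk_le_mk.mpr (Nat.lt_succ_iff.mp (Finset.mem_filter.mp hl).2)))
  rw [card_filter_lt (by omega)] at hK
  push_cast at hK
  rw [partialSum]
  linarith

/-- The partial sums are concave, so they are positive between `0` and `n` as soon as the total is
nonnegative and the sequence is not identically zero. -/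
lemma partialSum_pos (hc : Antitone c) (hsum : 0 ≤ ∑ l, c l) (hne : ∃ l, c l ≠ 0)
    {k : ℕ} (h0 : 0 < k) (hk : k < n) : 0 < partialSum c k := by
  by_contra hneg
  rw [not_lt] at hneg
  set d := c ⟨k, hk⟩ with hd
  have hfirst : ∀ l ∈ Finset.univ.filter (fun l : Fin n => (l : ℕ) < k), d ≤ c l := fun l hl =>
    hc (show l ≤ (⟨k, hk⟩ : Fin n) from Fin.mk_le_mk.mpr (Finset.mem_filter.mp hl).2.le)
  have hd0 : d ≤ 0 := by
    have := Finset.card_nsmul_le_sum _ _ _ hfirst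
    rw [card_filter_lt hk.le, nsmul_eq_mul] at this
    by_contra hpos
    have h3 : (0 : ℚ) < k * d := mul_pos (by exact_mod_cast h0) (not_le.mp hpos)
    exact absurd (lt_of_lt_of_le h3 this) (not_lt.mpr hneg)
  have hlast : ∀ l ∈ Finset.univ.filter (fun l : Fin n => ¬ (l : ℕ) < k), c l ≤ 0 := fun l hl =>
    (hc (show (⟨k, hk⟩ : Fin n) ≤ l from
      Fin.mk_le_mk.mpr (not_lt.mp (Finset.mem_filter.mp hl).2))).trans hd0
  have hsplit := Finset.sum_filter_add_sum_filter_not Finset.univ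
    (fun l : Fin n => (l : ℕ) < k) c
  have hlast0 := Finset.sum_nonpos hlast
  rw [partialSum] at hneg
  have hz : ∀ l ∈ Finset.univ.filter (fun l : Fin n => ¬ (l : ℕ) < k), c l = 0 :=
    (Finset.sum_eq_zero_iff_of_nonpos hlast).mp (by linarith)
  have hdz : d = 0 := hz _ (Finset.mem_filter.mpr ⟨Finset.mem_univ _, lt_irrefl k⟩)
  rw [hdz] at hfirst
  have hz' := (Finset.sum_eq_zero_iff_of_nonneg hfirst).mp (by linarith)
  obtain ⟨l, hl⟩ := hne
  by_cases hlk : (l : ℕ) < k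
  · exact hl (hz' l (Finset.mem_filter.mpr ⟨Finset.mem_univ _, hlk⟩))
  · exact hl (hz l (Finset.mem_filter.mpr ⟨Finset.mem_univ _, hlk⟩))

end Slopes

/-! ### The Newton polygon -/

/-- A set contained in a closed half-plane has its interior in the open half-plane. -/
lemma lt_of_mem_interior_of_subset {S : Set (ℝ × ℝ)} {α β γ : ℝ} (hαβ : 0 < α ^ 2 + β ^ 2)
    (hS : ∀ p ∈ S, α * p.1 + β * p.2 ≤ γ) {p : ℝ × ℝ} (hp : p ∈ interior S) :
    α * p.1 + β * p.2 < γ := by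
  -- move from `p` in the direction of the normal
  have hcont : Continuous fun t : ℝ => ((p.1 + t * α, p.2 + t * β) : ℝ × ℝ) := by fun_prop
  have hmem : (fun t : ℝ => ((p.1 + t * α, p.2 + t * β) : ℝ × ℝ)) ⁻¹' interior S ∈
      nhds (0 : ℝ) :=
    hcont.continuousAt.preimage_mem_nhds (by simpa using isOpen_interior.mem_nhds hp)
  obtain ⟨ε, hε, hball⟩ := Metric.mem_nhds_iff.mp hmem
  have h1 : (ε / 2) ∈ Metric.ball (0 : ℝ) ε := by
    rw [Metric.mem_ball, dist_zero_right, Real.norm_eq_abs, abs_of_pos (by positivity)]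
    linarith
  have h2 := hS _ (interior_subset (hball h1))
  have h3 : 0 < ε / 2 * (α ^ 2 + β ^ 2) := by positivity
  simp only at h2
  nlinarith

lemma le_of_mem_newtonPolygon {χ : ℂ[X][X]} {α β γ : ℝ}
    (h : ∀ a m : ℕ, (χ.coeff m).coeff a ≠ 0 → α * a + β * m ≤ γ) :
    ∀ p ∈ newtonPolygon χ, α * p.1 + β * p.2 ≤ γ := by
  have hlin : IsLinearMap ℝ fun p : ℝ × ℝ => α * p.1 + β * p.2 :=
    ⟨fun p q => by simp only [Prod.fst_add, Prod.snd_add]; ring,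
      fun t p => by simp only [Prod.smul_fst, Prod.smul_snd, smul_eq_mul]; ring⟩
  refine convexHull_min ?_ (convex_halfSpace_le hlin γ)
  rintro _ ⟨a, m, ham, rfl⟩
  exact h a m ham

lemma convex_newtonPolygon (χ : ℂ[X][X]) : Convex ℝ (newtonPolygon χ) :=
  convex_convexHull ℝ _

lemma mem_newtonPolygon {χ : ℂ[X][X]} {a m : ℕ} (h : (χ.coeff m).coeff a ≠ 0) :
    ((a : ℝ), (m : ℝ)) ∈ newtonPolygon χ :=
  subset_convexHull ℝ _ ⟨a, m, h, rfl⟩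

/-- The interior of a triangle with a vertical side on the axis `x = 0`, at the height of the
opposite vertex. -/
lemma mem_interior_of_triangle {S : Set (ℝ × ℝ)} (hS : Convex ℝ S) {N m H a : ℝ}
    (hbot : ((0 : ℝ), (0 : ℝ)) ∈ S) (htop : ((0 : ℝ), N) ∈ S) (hvert : (H, m) ∈ S)
    (hm0 : 0 < m) (hmN : m < N) (ha0 : 0 < a) (haH : a < H) : (a, m) ∈ interior S := by
  have hN : 0 < N := hm0.trans hmN
  have hH : 0 < H := ha0.trans haH
  set U : Set (ℝ × ℝ) := {p | 0 < p.1 ∧ p.1 < H ∧ p.1 * m < p.2 * H ∧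
    p.2 * H < p.1 * m + (H - p.1) * N} with hU
  have hopen : IsOpen U := by
    have e1 : IsOpen {p : ℝ × ℝ | 0 < p.1} := isOpen_lt (by fun_prop) (by fun_prop)
    have e2 : IsOpen {p : ℝ × ℝ | p.1 < H} := isOpen_lt (by fun_prop) (by fun_prop)
    have e3 : IsOpen {p : ℝ × ℝ | p.1 * m < p.2 * H} := isOpen_lt (by fun_prop) (by fun_prop)
    have e4 : IsOpen {p : ℝ × ℝ | p.2 * H < p.1 * m + (H - p.1) * N} :=
      isOpen_lt (by fun_prop) (by fun_prop)
    exact e1.inter (e2.inter (e3.inter e4))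
  have hsub : U ⊆ S := by
    rintro ⟨x, z⟩ ⟨h1, h2, h3, h4⟩
    simp only at h1 h2 h3 h4
    have hden : 0 < (H - x) * N := mul_pos (by linarith) hN
    -- the point of the vertical side on the line through `(H, m)` and `(x, z)`
    set s : ℝ := (z * H - x * m) / ((H - x) * N) with hs
    have hs0 : 0 ≤ s := div_nonneg (by linarith) hden.le
    have hs1 : s ≤ 1 := (div_le_one hden).mpr (by linarith)
    have hside : ((0 : ℝ), s * N) ∈ S := by
      have := hS hbot htop (sub_nonneg.mpr hs1) hs0 (by ring)
      simpa using this
    have := hS hside hvert (a := 1 - x / H) (b := x / H)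
      (sub_nonneg.mpr ((div_le_one hH).mpr h2.le)) (by positivity) (by ring)
    convert this using 1
    have hHx : H - x ≠ 0 := by linarith
    ext
    · simp only [Prod.smul_mk, Prod.mk_add_mk, smul_eq_mul]
      field_simp
      ring
    · simp only [Prod.smul_mk, Prod.mk_add_mk, smul_eq_mul, hs]
      field_simp
      ring
  refine interior_maximal hsub hopen ⟨ha0, haH, ?_, ?_⟩
  · nlinarith
  · nlinarith [mul_pos (sub_pos.mpr haH) (sub_pos.mpr hmN)]

section Roots

variable {n : ℕ} {χ : ℂ[X][X]} {y : Fin n → HahnSeries ℚ ℂ}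

lemma root_ne_zero (hconst : (χ.coeff 0).coeff 0 ≠ 0)
    (hroots : χ.map toSeries = ∏ l, (X - C (y l))) (l : Fin n) : y l ≠ 0 := by
  intro hl
  have h : (χ.map toSeries).coeff 0 = 0 := by
    rw [hroots, coeff_zero_eq_eval_zero, eval_prod]
    exact Finset.prod_eq_zero (Finset.mem_univ l) (by simp [hl])
  rw [coeff_map, toSeries_eq_polySeries, map_eq_zero_iff _ polySeries_injective] at h
  simp [h] at hconst

/-- The exponents of `χ` lie in a supporting half-plane of each slope `h`. -/
lemma exponent_le (hy : ∀ l, y l ≠ 0) (hroots : χ.map toSeries = ∏ l, (X - C (y l))) (h : ℚ)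
    {a m : ℕ} (ham : (χ.coeff m).coeff a ≠ 0) :
    (a : ℚ) + m * h ≤ ∑ l, max (highestExponent (y l)) h := by
  have h1 := le_addVal_coeff_prod y hy h Finset.univ m
  rw [← hroots, coeff_map, toSeries_eq_polySeries] at h1
  have h2 : HahnSeries.addVal ℚ ℂ (polySeries (χ.coeff m)) ≤ ((-(a : ℚ) : ℚ) : WithTop ℚ) :=
    HahnSeries.addVal_le_of_coeff_ne_zero (by rwa [coeff_polySeries_neg_natCast])
  have h3 := h1.trans h2
  rw [WithTop.coe_le_coe] at h3
  simp only [highestExponent]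
  linarith

lemma add_mul_lt_of_mem_interiorPoints (hy : ∀ l, y l ≠ 0)
    (hroots : χ.map toSeries = ∏ l, (X - C (y l))) (h : ℚ) {p : ℤ × ℤ}
    (hp : p ∈ interiorPoints χ) :
    (p.1 : ℚ) + p.2 * h < ∑ l, max (highestExponent (y l)) h := by
  have := lt_of_mem_interior_of_subset (α := 1) (β := h)
    (γ := ((∑ l, max (highestExponent (y l)) h : ℚ) : ℝ)) (by positivity)
    (le_of_mem_newtonPolygon fun a m ham => by
      have := exponent_le hy hroots h ham
      rw [one_mul, mul_comm]
      exact_mod_cast this) hp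
  simp only [one_mul] at this
  rw [mul_comm] at this
  exact_mod_cast this

/-- A dominant product of roots gives a vertex of the Newton polygon. -/
lemma mem_newtonPolygon_of_dominant (hy : ∀ l, y l ≠ 0)
    (hroots : χ.map toSeries = ∏ l, (X - C (y l))) (T : Finset (Fin n))
    (hT : ∀ S : Finset (Fin n), S.card = T.card → S ≠ T →
      ∑ l ∈ S, highestExponent (y l) < ∑ l ∈ T, highestExponent (y l)) :
    ∃ a : ℕ, (a : ℚ) = ∑ l ∈ T, highestExponent (y l) ∧
      ((a : ℝ), ((n - T.card : ℕ) : ℝ)) ∈ newtonPolygon χ := by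
  have h := addVal_coeff_prod_of_dominant y hy T fun S h1 h2 => by
    have := hT S h1 h2
    simp only [highestExponent, Finset.sum_neg_distrib] at this
    linarith
  rw [← hroots, coeff_map, toSeries_eq_polySeries, Fintype.card_fin] at h
  have hne : χ.coeff (n - T.card) ≠ 0 := by
    intro h0
    rw [h0, map_zero, AddValuation.map_zero] at h
    exact WithTop.top_ne_coe h
  rw [addVal_polySeries hne, WithTop.coe_eq_coe] at h
  refine ⟨_, ?_, mem_newtonPolygon (leadingCoeff_ne_zero.mpr hne)⟩
  simp only [highestExponent, Finset.sum_neg_distrib]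
  linarith

/-- Every partial sum is on the polygon, on the edge whose ends are given by the roots with
exponent larger than, and at least equal to, its last term. -/
lemma partialSum_mem_newtonPolygon (hmonic : χ.Monic) (hdeg : χ.natDegree = n)
    (hy : ∀ l, y l ≠ 0) (hroots : χ.map toSeries = ∏ l, (X - C (y l)))
    (horder : Antitone fun l => highestExponent (y l)) {k : ℕ} (hk : k ≤ n) :
    (((partialSum (fun l => highestExponent (y l)) k : ℚ) : ℝ), ((n : ℝ) - k)) ∈
      newtonPolygon χ := by
  classical
  cases k with
  | zero =>
    have := mem_newtonPolygon (χ := χ) (a := 0) (m := n)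
      (by rw [← hdeg, hmonic.coeff_natDegree]; simp)
    simpa [partialSum] using this
  | succ k =>
    set c : Fin n → ℚ := fun l => highestExponent (y l) with hcdef
    have hk' : k < n := hk
    set h := c ⟨k, hk'⟩ with hh
    set S0 := Finset.univ.filter fun l => h < c l with hS0
    set S1 := Finset.univ.filter fun l => h ≤ c l with hS1
    have e0 := partialSum_add_mul horder hk' (A := S0) (by simp [hS0, hh, hcdef])
      (fun l hl => (Finset.mem_filter.mp hl).2.le)
    have e1 := partialSum_add_mul horder hk' (A := S1)
      (fun l hl => Finset.mem_filter.mpr ⟨Finset.mem_univ _, le_of_lt hl⟩)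
      (fun l hl => (Finset.mem_filter.mp hl).2)
    obtain ⟨a0, ha0, hm0⟩ := mem_newtonPolygon_of_dominant hy hroots S0 fun S hS1 hS2 =>
      sum_lt_sum_of_slope h S S0 (Or.inl (by simp [hS0, hcdef])) hS1 hS2
    obtain ⟨a1, ha1, hm1⟩ := mem_newtonPolygon_of_dominant hy hroots S1 fun S hS1' hS2 =>
      sum_lt_sum_of_slope h S S1 (Or.inr (by simp [hS1, hcdef])) hS1' hS2
    have hc0 : S0.card < k + 1 := by
      have : S0 ⊆ Finset.univ.filter fun l : Fin n => (l : ℕ) < k := by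
        intro l hl
        refine Finset.mem_filter.mpr ⟨Finset.mem_univ _, ?_⟩
        by_contra hlk
        exact absurd (horder (show (⟨k, hk'⟩ : Fin n) ≤ l from Fin.mk_le_mk.mpr (by omega)))
          (not_le.mpr (Finset.mem_filter.mp hl).2)
      have := Finset.card_le_card this
      rw [card_filter_lt hk'.le] at this
      omega
    have hc1 : k + 1 ≤ S1.card := by
      rw [← card_filter_lt hk]
      refine Finset.card_le_card fun l hl => Finset.mem_filter.mpr ⟨Finset.mem_univ _, ?_⟩
      exact horder (show l ≤ (⟨k, hk'⟩ : Fin n) from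
        Fin.mk_le_mk.mpr (Nat.lt_succ_iff.mp (Finset.mem_filter.mp hl).2))
    have hn0 : S0.card ≤ n := by simpa using Finset.card_le_univ S0
    have hn1 : S1.card ≤ n := by simpa using Finset.card_le_univ S1
    rw [← ha0] at e0
    rw [← ha1] at e1
    set i : ℕ := S0.card
    set j : ℕ := S1.card
    set H := partialSum c (k + 1)
    have hij : (0 : ℝ) < (j : ℝ) - i := by
      have : (i : ℝ) < j := by exact_mod_cast (by omega : i < j)
      linarith
    have hi : (i : ℝ) ≤ k + 1 := by exact_mod_cast hc0.le
    have hj : (k : ℝ) + 1 ≤ j := by exact_mod_cast hc1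
    have e0' : (a0 : ℝ) = H + ((i : ℝ) - (k + 1)) * h := by exact_mod_cast e0
    have e1' : (a1 : ℝ) = H + ((j : ℝ) - (k + 1)) * h := by exact_mod_cast e1
    -- the point divides the segment between the vertices of `S0` and `S1`
    have := convex_newtonPolygon χ hm0 hm1
      (a := ((j : ℝ) - (k + 1)) / (j - i)) (b := ((k : ℝ) + 1 - i) / (j - i))
      (div_nonneg (by linarith) hij.le) (div_nonneg (by linarith) hij.le)
      (by rw [← add_div, div_eq_one_iff_eq hij.ne']; ring)
    convert this using 1
    rw [e0', e1', Nat.cast_sub hn0, Nat.cast_sub hn1]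
    ext
    · simp only [Prod.smul_mk, Prod.mk_add_mk, smul_eq_mul]
      field_simp
      ring
    · simp only [Prod.smul_mk, Prod.mk_add_mk, smul_eq_mul]
      push_cast
      field_simp
      ring

/-- A polynomial in `y` alone of degree at least `2` splits off a linear factor over `ℂ`. -/
lemma not_irreducible_of_coeff_const (hn : 2 ≤ χ.natDegree)
    (h : ∀ a m : ℕ, (χ.coeff m).coeff a ≠ 0 → a = 0) : ¬ Irreducible χ := by
  intro hirr
  set q : ℂ[X] := χ.map (evalRingHom 0) with hq
  have hχ : χ = q.map C := by
    ext m a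
    simp only [hq, coeff_map, coe_evalRingHom, coeff_C, ← coeff_zero_eq_eval_zero]
    split_ifs with ha
    · rw [ha]
    · by_contra h0
      exact ha (h a m h0)
  have hdeg : q.natDegree = χ.natDegree := by
    rw [hχ, natDegree_map_eq_of_injective C_injective]
  obtain ⟨z, hz⟩ := IsAlgClosed.exists_root q fun h0 => by
    have := natDegree_eq_zero_iff_degree_le_zero.mpr h0.le
    omega
  obtain ⟨s, hs⟩ := dvd_iff_isRoot.mpr hz
  have hχ' : χ = (X - C (C z)) * s.map C := by
    rw [hχ, hs]
    simp
  rcases hirr.isUnit_or_isUnit hχ' with hu | hu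
  · have := natDegree_eq_zero_of_isUnit hu
    simp at this
  · have h1 := natDegree_eq_zero_of_isUnit hu
    have h2 := natDegree_mul_le (p := X - C (C z)) (q := s.map C)
    rw [← hχ', h1, natDegree_X_sub_C] at h2
    omega

lemma partialSum_highestExponent_pos (hirr : Irreducible χ) (hdeg : χ.natDegree = n)
    (hy : ∀ l, y l ≠ 0) (hroots : χ.map toSeries = ∏ l, (X - C (y l)))
    (horder : Antitone fun l => highestExponent (y l)) {k : ℕ} (h0 : 0 < k) (hk : k < n) :
    0 < partialSum (fun l => highestExponent (y l)) k := by
  refine partialSum_pos horder ?_ ?_ h0 hk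
  · obtain ⟨a, ha, -⟩ := mem_newtonPolygon_of_dominant hy hroots Finset.univ fun S h1 h2 =>
      absurd ((Finset.card_eq_iff_eq_univ S).mp (by simpa using h1)) h2
    rw [← ha]
    positivity
  · by_contra hz
    push Not at hz
    refine not_irreducible_of_coeff_const (by omega) (fun a m ham => ?_) hirr
    have := exponent_le hy hroots 0 ham
    simp only [hz, max_self, Finset.sum_const_zero, mul_zero, add_zero] at this
    have h2 : a ≤ 0 := by exact_mod_cast this
    omega

/-- The right boundary of the Newton polygon passes at height `M` through the sum of the `n - M`
largest exponents. -/
lemma mem_interiorPoints_iff (hmonic : χ.Monic) (hdeg : χ.natDegree = n)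
    (hconst : (χ.coeff 0).coeff 0 ≠ 0) (hroots : χ.map toSeries = ∏ l, (X - C (y l)))
    (horder : Antitone fun l => highestExponent (y l)) (a M : ℤ) :
    (a, M) ∈ interiorPoints χ ↔ 0 < a ∧ 0 < M ∧ M < n ∧
      (a : ℚ) < partialSum (fun l => highestExponent (y l)) (n - M.toNat) := by
  have hy := root_ne_zero hconst hroots
  constructor
  · intro h
    have h1 := lt_of_mem_interior_of_subset (α := -1) (β := 0) (γ := 0) (by norm_num)
      (le_of_mem_newtonPolygon fun a m _ => by simp) h
    have h2 := lt_of_mem_interior_of_subset (α := 0) (β := -1) (γ := 0) (by norm_num)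
      (le_of_mem_newtonPolygon fun a m _ => by simp) h
    have h3 := lt_of_mem_interior_of_subset (α := 0) (β := 1) (γ := n) (by norm_num)
      (le_of_mem_newtonPolygon fun a m ham => by
        simp only [zero_mul, one_mul, zero_add, Nat.cast_le]
        rw [← hdeg]
        exact le_natDegree_of_ne_zero fun h0 => ham (by simp [h0])) h
    simp only [neg_mul, one_mul, zero_mul, add_zero, zero_add, Left.neg_neg_iff,
      Int.cast_pos] at h1 h2 h3
    have hMn : M < n := by exact_mod_cast h3
    refine ⟨h1, h2, hMn, ?_⟩
    lift M to ℕ using h2.le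
    simp only [Int.toNat_natCast]
    have hM0 : 0 < M := by exact_mod_cast h2
    have hMn' : M < n := by exact_mod_cast hMn
    -- the slope of the edge just below the height `M` gives the bound at `M` itself
    have h4 := add_mul_lt_of_mem_interiorPoints hy hroots
      (highestExponent (y ⟨n - M - 1, by omega⟩)) h
    rw [sum_max_eq horder, show n - M - 1 + 1 = n - M by omega,
      show ((n - M - 1 : ℕ) : ℚ) = n - M - 1 by
        rw [Nat.cast_sub (by omega), Nat.cast_sub (by omega)]; simp] at h4
    push_cast at h4
    linarith
  · rintro ⟨ha, hM, hMn, hlt⟩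
    lift M to ℕ using hM.le
    simp only [Int.toNat_natCast] at hlt
    have hMn' : M < n := by exact_mod_cast hMn
    have hvert := partialSum_mem_newtonPolygon hmonic hdeg hy hroots horder
      (k := n - M) (by omega)
    have htop := partialSum_mem_newtonPolygon hmonic hdeg hy hroots horder
      (k := 0) (by omega)
    rw [show (n : ℝ) - (n - M : ℕ) = M by rw [Nat.cast_sub hMn'.le]; ring] at hvert
    have hbot := mem_newtonPolygon hconst
    rw [Nat.cast_zero] at hbot
    simp only [partialSum, not_lt_zero, Finset.filter_false, Finset.sum_empty, Rat.cast_zero,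
      Nat.cast_zero, sub_zero] at htop
    have e1 : (0 : ℝ) < (M : ℤ) := by exact_mod_cast hM
    have e2 : (((M : ℤ)) : ℝ) < n := by exact_mod_cast hMn
    have e3 : (0 : ℝ) < a := by exact_mod_cast ha
    exact mem_interior_of_triangle (convex_newtonPolygon χ) hbot htop hvert e1 e2 e3
      (by exact_mod_cast hlt)

end Roots

/-! ### Counting the interior lattice points -/

section Count

variable {n : ℕ} {χ : ℂ[X][X]} {y : Fin n → HahnSeries ℚ ℂ}

lemma mem_tauSet_iff (hmonic : χ.Monic) (hdeg : χ.natDegree = n)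
    (hconst : (χ.coeff 0).coeff 0 ≠ 0) (hroots : χ.map toSeries = ∏ l, (X - C (y l)))
    (horder : Antitone fun l => highestExponent (y l)) {m : ℕ} (hm : m + 2 ≤ n) (t : ℤ) :
    t ∈ tauSet χ m ↔
      0 ≤ t ∧ t ≤ ⌈partialSum (fun l => highestExponent (y l)) (n - m - 1)⌉ - 2 := by
  rw [tauSet, Set.mem_ofPred_eq, mem_interiorPoints_iff hmonic hdeg hconst hroots horder,
    show ((m : ℤ) + 1).toNat = m + 1 by omega, Nat.sub_add_eq, ← Int.lt_ceil]
  omega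

lemma isGreatest_tauSet (hmonic : χ.Monic) (hdeg : χ.natDegree = n)
    (hconst : (χ.coeff 0).coeff 0 ≠ 0) (hroots : χ.map toSeries = ∏ l, (X - C (y l)))
    (horder : Antitone fun l => highestExponent (y l)) {m : ℕ} (hm : m + 2 ≤ n)
    (h : (tauSet χ m).Nonempty) :
    IsGreatest (tauSet χ m)
      (⌈partialSum (fun l => highestExponent (y l)) (n - m - 1)⌉ - 2) := by
  have hmem := mem_tauSet_iff hmonic hdeg hconst hroots horder hm
  obtain ⟨t, ht⟩ := h
  have := (hmem t).mp ht
  exact ⟨(hmem _).mpr ⟨by omega, le_rfl⟩, fun s hs => ((hmem s).mp hs).2⟩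

lemma tau_eq (hirr : Irreducible χ) (hmonic : χ.Monic) (hdeg : χ.natDegree = n)
    (hconst : (χ.coeff 0).coeff 0 ≠ 0) (hroots : χ.map toSeries = ∏ l, (X - C (y l)))
    (horder : Antitone fun l => highestExponent (y l)) {m : ℕ} (hm : m + 2 ≤ n) :
    tau χ m = ⌈partialSum (fun l => highestExponent (y l)) (n - m - 1)⌉ - 2 := by
  rw [tau]
  split_ifs with h
  · exact (isGreatest_tauSet hmonic hdeg hconst hroots horder hm h).csSup_eq
  · -- an empty row: the ceiling is `1`, as the partial sum is positive
    have hpos := partialSum_highestExponent_pos hirr hdeg (root_ne_zero hconst hroots) hroots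
      horder (k := n - m - 1) (by omega) (by omega)
    have h1 := Int.ceil_pos.mpr hpos
    have h2 : ¬ (0 : ℤ) ∈ tauSet χ m := fun h0 => h ⟨0, h0⟩
    rw [mem_tauSet_iff hmonic hdeg hconst hroots horder hm] at h2
    omega

/-- The interior lattice points, listed row by row. -/
lemma interiorPoints_eq (hirr : Irreducible χ) (hmonic : χ.Monic) (hdeg : χ.natDegree = n)
    (hconst : (χ.coeff 0).coeff 0 ≠ 0) (hroots : χ.map toSeries = ∏ l, (X - C (y l)))
    (horder : Antitone fun l => highestExponent (y l)) :
    interiorPoints χ = ((Finset.range (n - 1)).biUnion fun m =>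
      (Finset.Icc 1 (tau χ m + 1)).image fun a => (a, (m : ℤ) + 1) : Finset (ℤ × ℤ)) := by
  ext ⟨a, M⟩
  simp only [Finset.coe_biUnion, Finset.coe_image, Set.mem_iUnion, Set.mem_image,
    Finset.mem_coe, Finset.mem_range, Finset.mem_Icc, Prod.mk.injEq]
  constructor
  · intro h
    have h' := h
    rw [mem_interiorPoints_iff hmonic hdeg hconst hroots horder] at h'
    refine ⟨M.toNat - 1, by omega, a, ⟨by omega, ?_⟩, rfl, by omega⟩
    have ht : a - 1 ∈ tauSet χ (M.toNat - 1) := by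
      rw [tauSet, Set.mem_ofPred_eq, show a - 1 + 1 = a by omega,
        show ((M.toNat - 1 : ℕ) : ℤ) + 1 = M by omega]
      exact h
    have hm : M.toNat - 1 + 2 ≤ n := by omega
    rw [mem_tauSet_iff hmonic hdeg hconst hroots horder hm] at ht
    rw [tau_eq hirr hmonic hdeg hconst hroots horder hm]
    omega
  · rintro ⟨m, hm, a', ⟨h1, h2⟩, rfl, rfl⟩
    have hm' : m + 2 ≤ n := by omega
    rw [tau_eq hirr hmonic hdeg hconst hroots horder hm'] at h2
    have ht : a' - 1 ∈ tauSet χ m :=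
      (mem_tauSet_iff hmonic hdeg hconst hroots horder hm' _).mpr ⟨by omega, by omega⟩
    rw [tauSet, Set.mem_ofPred_eq, show a' - 1 + 1 = a' by omega] at ht
    exact ht

lemma ncard_interiorPoints (hirr : Irreducible χ) (hmonic : χ.Monic) (hdeg : χ.natDegree = n)
    (hconst : (χ.coeff 0).coeff 0 ≠ 0) (hroots : χ.map toSeries = ∏ l, (X - C (y l)))
    (horder : Antitone fun l => highestExponent (y l)) :
    ((interiorPoints χ).ncard : ℤ) = ∑ m ∈ Finset.range (n - 1), (tau χ m + 1) := by
  rw [interiorPoints_eq hirr hmonic hdeg hconst hroots horder, Set.ncard_coe_finset,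
    Finset.card_biUnion]
  · push_cast
    refine Finset.sum_congr rfl fun m hm => ?_
    rw [Finset.mem_range] at hm
    have hpos := partialSum_highestExponent_pos hirr hdeg (root_ne_zero hconst hroots) hroots
      horder (k := n - m - 1) (by omega) (by omega)
    have h1 := Int.ceil_pos.mpr hpos
    rw [Finset.card_image_of_injective _ fun a b h => (Prod.mk.inj h).1, Int.card_Icc,
      tau_eq hirr hmonic hdeg hconst hroots horder (by omega)]
    omega
  · intro i _ j _ hij
    rw [Function.onFun, Finset.disjoint_left]
    simp only [Finset.mem_image, not_exists, not_and]
    rintro _ ⟨a, -, rfl⟩ b - h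
    have := (Prod.mk.inj h).2
    omega

end Count

/-! ### The space of differentials -/

section Differentials

variable {χ : ℂ[X][X]}

lemma one_le_of_mem_interiorPoints {p : ℤ × ℤ} (hp : p ∈ interiorPoints χ) :
    1 ≤ p.1 ∧ 1 ≤ p.2 := by
  have h1 := lt_of_mem_interior_of_subset (α := -1) (β := 0) (γ := 0) (by norm_num)
    (le_of_mem_newtonPolygon fun a m _ => by simp) hp
  have h2 := lt_of_mem_interior_of_subset (α := 0) (β := -1) (γ := 0) (by norm_num)
    (le_of_mem_newtonPolygon fun a m _ => by simp) hp
  simp only [neg_mul, one_mul, zero_mul, add_zero, zero_add, Left.neg_neg_iff, Int.cast_pos]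
    at h1 h2
  exact ⟨h1, h2⟩

/-- The coefficients of a numerator at the interior lattice points. -/
noncomputable def interiorCoeffs (χ : ℂ[X][X]) : numerators χ →ₗ[ℂ] (interiorPoints χ → ℂ) where
  toFun g p := ((g : ℂ[X][X]).coeff (p.1.2 - 1).toNat).coeff (p.1.1 - 1).toNat
  map_add' f g := by ext p; simp
  map_smul' c g := by ext p; simp

lemma interiorCoeffs_bijective (hfin : (interiorPoints χ).Finite) :
    Function.Bijective (interiorCoeffs χ) := by
  have := hfin.fintype
  constructor
  · rw [injective_iff_map_eq_zero]
    intro g hg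
    ext m a
    by_contra hne
    have := congrFun hg ⟨_, g.2 a m hne⟩
    simp only [interiorCoeffs, LinearMap.coe_mk, AddHom.coe_mk, Pi.zero_apply,
      add_sub_cancel_right, Int.toNat_natCast] at this
    exact hne this
  · intro c
    refine ⟨⟨∑ p : interiorPoints χ, monomial (p.1.2 - 1).toNat
      (monomial (p.1.1 - 1).toNat (c p)), Submodule.sum_mem _ fun p _ => ?_⟩, ?_⟩
    · intro a m hne
      obtain ⟨h1, h2⟩ := one_le_of_mem_interiorPoints p.2
      rw [coeff_monomial] at hne
      split_ifs at hne with hm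
      · rw [coeff_monomial] at hne
        split_ifs at hne with ha
        · convert p.2 using 1
          ext <;> simp only <;> omega
        · exact absurd rfl hne
      · simp at hne
    · ext p
      simp only [interiorCoeffs, LinearMap.coe_mk, AddHom.coe_mk, finsetSum_coeff]
      rw [Finset.sum_eq_single p]
      · simp
      · intro q _ hqp
        obtain ⟨h1, h2⟩ := one_le_of_mem_interiorPoints p.2
        obtain ⟨h3, h4⟩ := one_le_of_mem_interiorPoints q.2
        rw [coeff_monomial]
        split_ifs with h5
        · rw [coeff_monomial, if_neg]
          intro h6
          exact hqp (Subtype.ext (Prod.ext (by omega) (by omega)))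
        · simp
      · simp

lemma natDegree_lt_of_mem_numerators {g : ℂ[X][X]} (hg : g ∈ numerators χ)
    (hdeg : 0 < χ.natDegree) : g.natDegree < χ.natDegree := by
  by_cases h0 : g = 0
  · rwa [h0, natDegree_zero]
  have hlead : (g.coeff g.natDegree).coeff (g.coeff g.natDegree).natDegree ≠ 0 :=
    leadingCoeff_ne_zero.mpr (leadingCoeff_ne_zero.mpr h0)
  have h := lt_of_mem_interior_of_subset (α := 0) (β := 1) (γ := χ.natDegree) (by norm_num)
    (le_of_mem_newtonPolygon fun a m ham => by
      simp only [zero_mul, one_mul, zero_add, Nat.cast_le]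
      exact le_natDegree_of_ne_zero fun h0 => ham (by simp [h0])) (hg _ _ hlead)
  simp only [zero_mul, one_mul, zero_add] at h
  have : (g.natDegree : ℤ) + 1 < χ.natDegree := by exact_mod_cast h
  omega

lemma algebraMap_polynomial_injective (hmonic : χ.Monic) (hdeg : 0 < χ.natDegree) :
    Function.Injective (algebraMap ℂ[X] (FunctionField χ)) := by
  rw [IsScalarTower.algebraMap_eq ℂ[X] (AdjoinRoot χ) (FunctionField χ), RingHom.coe_comp]
  refine (IsFractionRing.injective _ _).comp ?_
  rw [AdjoinRoot.algebraMap_eq]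
  refine AdjoinRoot.of.injective_of_degree_ne_zero ?_
  rw [degree_eq_natDegree hmonic.ne_zero]
  exact_mod_cast hdeg.ne'

lemma aevalAeval_coord (g : ℂ[X][X]) : aevalAeval (coordX χ) (coordY χ) g =
    algebraMap (AdjoinRoot χ) (FunctionField χ) (AdjoinRoot.mk χ g) := by
  have h : (aevalAeval (coordX χ) (coordY χ)).toRingHom =
      (algebraMap (AdjoinRoot χ) (FunctionField χ)).comp (AdjoinRoot.mk χ) := by
    refine ringHom_ext' (ringHom_ext (fun c => ?_) ?_) ?_
    · simp
      rfl
    · simp [coordX]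
    · simp [coordY]
  exact RingHom.congr_fun h g

lemma aevalAeval_coord_ne_zero (hmonic : χ.Monic) {g : ℂ[X][X]} (hg : g ≠ 0)
    (hdeg : g.natDegree < χ.natDegree) : aevalAeval (coordX χ) (coordY χ) g ≠ 0 := by
  rw [aevalAeval_coord, Ne, map_eq_zero_iff _ (IsFractionRing.injective _ _),
    AdjoinRoot.mk_eq_zero]
  exact hmonic.not_dvd_of_natDegree_lt hg hdeg

variable [Fact (Irreducible χ)]

/-- `x` is a separating element: the function field is formally étale over `ℂ[x]`, so that its
differentials are obtained from those of `ℂ[x]` by base change. -/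
lemma D_coordX_ne_zero (hmonic : χ.Monic) (hdeg : 0 < χ.natDegree) :
    KaehlerDifferential.D ℂ (FunctionField χ) (coordX χ) ≠ 0 := by
  have hinj := algebraMap_polynomial_injective hmonic hdeg
  have : FaithfulSMul ℂ[X] (FunctionField χ) := (faithfulSMul_iff_algebraMap_injective _ _).mpr hinj
  let : Algebra (FractionRing ℂ[X]) (FunctionField χ) := FractionRing.liftAlgebra ℂ[X] _
  have : Module.Finite ℂ[X] (AdjoinRoot χ) := hmonic.finite_adjoinRoot
  have : Algebra.IsAlgebraic ℂ[X] (FunctionField χ) :=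
    (IsFractionRing.isAlgebraic_iff' ℂ[X] (AdjoinRoot χ) (FunctionField χ)).mp inferInstance
  have : Algebra.IsAlgebraic (FractionRing ℂ[X]) (FunctionField χ) :=
    IsFractionRing.comap_isAlgebraic_iff (A := ℂ[X]).mp inferInstance
  have : Algebra.FormallyEtale (FractionRing ℂ[X]) (FunctionField χ) :=
    Algebra.FormallyEtale.of_isSeparable _ _
  have : Algebra.FormallyEtale ℂ[X] (FractionRing ℂ[X]) :=
    Algebra.FormallyEtale.of_isLocalization (nonZeroDivisors ℂ[X])
  have : Algebra.FormallyEtale ℂ[X] (FunctionField χ) :=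
    Algebra.FormallyEtale.comp _ (FractionRing ℂ[X]) _
  intro h
  have h1 := KaehlerDifferential.tensorKaehlerEquivOfFormallyEtale_symm_D_algebraMap
    ℂ ℂ[X] (FunctionField χ) X
  have hX : algebraMap ℂ[X] (FunctionField χ) X = coordX χ := rfl
  rw [hX, h, map_zero] at h1
  have h2 := congrArg (TensorProduct.rid ℂ[X] (FunctionField χ) ∘ LinearMap.lTensor
    (FunctionField χ) (KaehlerDifferential.polynomialEquiv ℂ).toLinearMap) h1
  simp at h2

/-- The map sending a numerator to its differential form. -/
noncomputable def toDifferential (χ : ℂ[X][X]) [Fact (Irreducible χ)] :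
    numerators χ →ₗ[ℂ] KaehlerDifferential ℂ (FunctionField χ) where
  toFun g := ratValue χ g (coordX χ) (coordY χ) •
    KaehlerDifferential.D ℂ (FunctionField χ) (coordX χ)
  map_add' f g := by simp [ratValue, add_div, add_smul]
  map_smul' c f := by
    simp only [ratValue, SetLike.val_smul, map_smul, smul_div_assoc, smul_assoc, RingHom.id_apply]

lemma range_toDifferential : LinearMap.range (toDifferential χ) = differentials χ := by
  ext ω
  constructor
  · rintro ⟨g, rfl⟩
    exact ⟨g, g.2, rfl⟩
  · rintro ⟨g, hg, rfl⟩
    exact ⟨⟨g, hg⟩, rfl⟩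

lemma toDifferential_injective (hmonic : χ.Monic) (hdeg : 0 < χ.natDegree) :
    Function.Injective (toDifferential χ) := by
  rw [injective_iff_map_eq_zero]
  intro g hg
  by_contra hne
  have hne' : (g : ℂ[X][X]) ≠ 0 := fun h => hne (Subtype.ext h)
  have hder : derivative χ ≠ 0 := by
    intro h
    exact hdeg.ne' (derivative_eq_zero.mp h)
  rcases smul_eq_zero.mp hg with h | h
  · rcases div_eq_zero_iff.mp h with h | h
    · exact aevalAeval_coord_ne_zero hmonic hne' (natDegree_lt_of_mem_numerators g.2 hdeg) h
    · exact aevalAeval_coord_ne_zero hmonic hder (natDegree_derivative_lt hdeg.ne') h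
  · exact D_coordX_ne_zero hmonic hdeg h

lemma finiteDimensional_differentials (hfin : (interiorPoints χ).Finite) :
    FiniteDimensional ℂ (differentials χ) := by
  have := hfin.fintype
  have : FiniteDimensional ℂ (numerators χ) :=
    Module.Finite.equiv (LinearEquiv.ofBijective _ (interiorCoeffs_bijective hfin)).symm
  rw [← range_toDifferential]
  infer_instance

lemma finrank_differentials (hmonic : χ.Monic) (hdeg : 0 < χ.natDegree)
    (hfin : (interiorPoints χ).Finite) :
    Module.finrank ℂ (differentials χ) = (interiorPoints χ).ncard := by
  have := hfin.fintype
  rw [← range_toDifferential, LinearMap.finrank_range_of_inj (toDifferential_injective hmonic hdeg),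
    (LinearEquiv.ofBijective _ (interiorCoeffs_bijective hfin)).finrank_eq,
    Module.finrank_fintype_fun_eq_card, Set.ncard_eq_toFinset_card', Set.toFinset_card]

end Differentials

/-! ### Lagrange interpolation and Euler's formula -/

section Lagrange

variable {F : Type*} [Field F]

/-- Euler's formula: the sum of `h / p'` over the roots of `p` is the coefficient of
`X ^ (deg p - 1)` in the remainder of `h` modulo `p`. -/
lemma coeff_modByMonic_prod {ι : Type*} (s : Finset ι) {v : ι → F} (hv : Set.InjOn v s)
    (h : F[X]) :
    (h %ₘ ∏ i ∈ s, (X - C (v i))).coeff (s.card - 1) =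
      ∑ i ∈ s, h.eval (v i) / (derivative (∏ i ∈ s, (X - C (v i)))).eval (v i) := by
  classical
  rw [← Lagrange.nodal_eq]
  have hm : (Lagrange.nodal s v).Monic := Lagrange.nodal_monic
  have hdeg : (h %ₘ Lagrange.nodal s v).degree < s.card := by
    rw [← Lagrange.degree_nodal (s := s) (v := v)]
    exact degree_modByMonic_lt _ hm
  rw [Lagrange.coeff_eq_sum hv hdeg]
  refine Finset.sum_congr rfl fun i hi => ?_
  rw [Lagrange.eval_nodal_derivative_eval_node_eq hi, Lagrange.eval_nodal]
  congr 1
  have := congrArg (eval (v i)) (modByMonic_add_div h (Lagrange.nodal s v))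
  rwa [eval_add, eval_mul, Lagrange.eval_nodal_at_node hi, zero_mul, add_zero] at this

lemma prod_roots_toFinset [DecidableEq F] {p : F[X]} (hsep : p.Separable) (hs : p.Splits) :
    p = C p.leadingCoeff * ∏ z ∈ p.roots.toFinset, (X - C z) := by
  conv_lhs => rw [hs.eq_prod_roots]
  rw [Finset.prod, Multiset.toFinset_val, (nodup_roots hsep).dedup]

lemma card_roots_toFinset [DecidableEq F] {p : F[X]} (hsep : p.Separable) (hs : p.Splits) :
    p.roots.toFinset.card = p.natDegree := by
  rw [Multiset.toFinset_card_of_nodup (nodup_roots hsep), hs.natDegree_eq_card_roots]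

lemma coeff_modByMonic_eq_sum_roots [DecidableEq F] {p : F[X]} (hm : p.Monic)
    (hsep : p.Separable) (hs : p.Splits) (h : F[X]) :
    (h %ₘ p).coeff (p.natDegree - 1) =
      ∑ z ∈ p.roots.toFinset, h.eval z / (derivative p).eval z := by
  have hp := prod_roots_toFinset hsep hs
  rw [hm.leadingCoeff, C_1, one_mul] at hp
  have := coeff_modByMonic_prod p.roots.toFinset (v := id) (fun _ _ _ _ h => h) h
  simp only [id_eq] at this
  rwa [← hp, card_roots_toFinset hsep hs] at this

lemma sum_eval_div_derivative_eq_zero [DecidableEq F] {r h : F[X]} (hsep : r.Separable)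
    (hs : r.Splits) (hdeg : h.natDegree + 1 < r.natDegree) :
    ∑ z ∈ r.roots.toFinset, h.eval z / (derivative r).eval z = 0 := by
  have hr := prod_roots_toFinset hsep hs
  set p := ∏ z ∈ r.roots.toFinset, (X - C z) with hp
  have hc : r.leadingCoeff ≠ 0 := leadingCoeff_ne_zero.mpr hsep.ne_zero
  have hpm : p.Monic := monic_prod_of_monic _ _ fun z _ => monic_X_sub_C z
  have hpdeg : p.natDegree = r.natDegree := by
    conv_rhs => rw [hr, natDegree_C_mul hc]
  have h1 := coeff_modByMonic_prod r.roots.toFinset (v := id) (fun _ _ _ _ h => h) h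
  simp only [id_eq] at h1
  rw [← hp, card_roots_toFinset hsep hs, (modByMonic_eq_self_iff hpm).mpr
    (degree_lt_degree (by omega)), coeff_eq_zero_of_natDegree_lt (by omega)] at h1
  have hder : derivative r = C r.leadingCoeff * derivative p := by
    conv_lhs => rw [hr, derivative_C_mul]
  rw [hder]
  simp only [eval_mul, eval_C, mul_comm r.leadingCoeff, ← div_div]
  rw [← Finset.sum_div, ← h1, zero_div]

end Lagrange

/-! ### Differentiating the coefficients of a polynomial -/

section CoeffDerivation

variable {A : Type*} [CommRing A] [Algebra ℂ A]

/-- The derivation of `A[X]` which applies `δ` to the coefficients and kills `X`. -/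
noncomputable def coeffDerivation (δ : Derivation ℂ A A) : Derivation ℂ A[X] A[X] :=
  PolynomialModule.equivPolynomialSelf.compDer δ.mapCoeffs

variable (δ : Derivation ℂ A A)

lemma coeff_coeffDerivation (p : A[X]) (k : ℕ) :
    (coeffDerivation δ p).coeff k = δ (p.coeff k) := rfl

lemma coeffDerivation_C (a : A) : coeffDerivation δ (C a) = C (δ a) := by
  ext k
  rw [coeff_coeffDerivation, coeff_C, coeff_C]
  split_ifs <;> simp

lemma coeffDerivation_monomial (k : ℕ) (a : A) :
    coeffDerivation δ (monomial k a) = monomial k (δ a) := by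
  ext j
  rw [coeff_coeffDerivation, coeff_monomial, coeff_monomial]
  split_ifs <;> simp

lemma derivation_eval (p : A[X]) (x : A) :
    δ (p.eval x) = (coeffDerivation δ p).eval x + (derivative p).eval x * δ x := by
  induction p using Polynomial.induction_on' with
  | add p q hp hq =>
    simp only [eval_add, map_add, hp, hq]
    ring
  | monomial k a =>
    rw [coeffDerivation_monomial, derivative_monomial, eval_monomial, eval_monomial, eval_monomial,
      Derivation.leibniz, Derivation.leibniz_pow]
    simp only [smul_eq_mul, nsmul_eq_mul]
    ring

lemma coeffDerivation_map_eq_zero (p : ℂ[X][X]) :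
    coeffDerivation (coeffDerivation δ) (p.map (mapRingHom (algebraMap ℂ A))) = 0 := by
  ext m a
  simp [coeff_coeffDerivation]

/-- If `r = a χ + b θ` eliminates `y`, then at a common zero `(x, y)` of `χ` and `θ` the
differential of `x` is `- b δθ / r'`, `δθ` being the variation of `θ` with its parameters. -/
lemma evalEval_mul_evalEval_coeffDerivation {χ θ a b : A[X][X]} {r : A[X]}
    (hχ : coeffDerivation (coeffDerivation δ) χ = 0) (hr : χ * a + θ * b = C r) {x z : A}
    (h1 : evalEval x z χ = 0) (h2 : evalEval x z θ = 0) :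
    evalEval x z b * evalEval x z (coeffDerivation (coeffDerivation δ) θ) =
      -((derivative r).eval x * δ x) := by
  have h0 : r.eval x = 0 := by
    have := congrArg (evalEval x z) hr
    simp only [evalEval_add, evalEval_mul, h1, h2, zero_mul, add_zero, evalEval_C] at this
    exact this.symm
  have h3 := congrArg (fun p => evalEval x z (coeffDerivation (coeffDerivation δ) p)) hr
  simp only [coeffDerivation_C, map_add, Derivation.leibniz, hχ, smul_eq_mul, mul_zero, add_zero,
    evalEval_add, evalEval_mul, h1, h2, zero_mul, zero_add, evalEval_C] at h3
  have h4 := derivation_eval δ r x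
  rw [h0, map_zero, ← h3] at h4
  linear_combination -h4

end CoeffDerivation

/-! ### Extending the field of coefficients of series -/

section BaseChange

variable {K : Type*} [Field K]

/-- Evaluation of a polynomial with parameters at the point `(x, z)`, `x = u⁻¹`. -/
noncomputable def seriesEval (z : HahnSeries ℚ K) : K[X][X] →+* HahnSeries ℚ K :=
  (evalRingHom z).comp (mapRingHom polySeries)

lemma seriesEval_apply (z : HahnSeries ℚ K) (p : K[X][X]) :
    seriesEval z p = (p.map polySeries).eval z := rfl

variable [Algebra ℂ K]

/-- The inclusion of the series over `ℂ` into the series over `K`. -/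
noncomputable def baseSeries : HahnSeries ℚ ℂ →+* HahnSeries ℚ K where
  toFun z := z.map (algebraMap ℂ K)
  map_zero' := by ext; simp
  map_one' := HahnSeries.map_one (algebraMap ℂ K).toMonoidWithZeroHom
  map_add' z w := HahnSeries.map_add (algebraMap ℂ K : ℂ →+ K)
  map_mul' z w := HahnSeries.map_mul (algebraMap ℂ K : ℂ →ₙ+* K)

lemma coeff_baseSeries (z : HahnSeries ℚ ℂ) (q : ℚ) :
    (baseSeries z : HahnSeries ℚ K).coeff q = algebraMap ℂ K (z.coeff q) := rfl

lemma order_baseSeries (z : HahnSeries ℚ ℂ) : (baseSeries z : HahnSeries ℚ K).order = z.order := by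
  by_cases hz : z = 0
  · simp [hz]
  have hz' : (baseSeries z : HahnSeries ℚ K) ≠ 0 :=
    (map_ne_zero_iff _ baseSeries.injective).mpr hz
  refine le_antisymm ?_ ?_
  · refine HahnSeries.order_le_of_coeff_ne_zero ?_
    rw [coeff_baseSeries, _root_.map_ne_zero]
    exact HahnSeries.coeff_order_eq_zero.not.mpr hz
  · refine HahnSeries.order_le_of_coeff_ne_zero ?_
    have := HahnSeries.coeff_order_eq_zero.not.mpr hz'
    rwa [coeff_baseSeries, map_eq_zero] at this

lemma baseSeries_comp_polySeries :
    (baseSeries (K := K)).comp polySeries = polySeries.comp (mapRingHom (algebraMap ℂ K)) := by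
  refine ringHom_ext (fun c => ?_) ?_ <;> ext q
  · simp only [polySeries, RingHom.comp_apply, coe_eval₂RingHom, eval₂_C, coe_mapRingHom, map_C,
      coeff_baseSeries, HahnSeries.C_apply, HahnSeries.coeff_single]
    split_ifs <;> simp
  · simp only [polySeries, RingHom.comp_apply, coe_eval₂RingHom, eval₂_X, coe_mapRingHom, map_X,
      coeff_baseSeries, HahnSeries.coeff_single]
    split_ifs <;> simp

lemma seriesEval_baseSeries (z : HahnSeries ℚ ℂ) (p : ℂ[X][X]) :
    seriesEval (baseSeries z : HahnSeries ℚ K) (p.map (mapRingHom (algebraMap ℂ K))) =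
      baseSeries ((p.map polySeries).eval z) := by
  rw [seriesEval_apply, map_map, ← baseSeries_comp_polySeries, ← map_map, eval_map_apply]

/-- Along a branch with constant coefficients, differentiating the parameters amounts to
differentiating the coefficients of the series. -/
lemma coeff_seriesEval_coeffDerivation (δ : Derivation ℂ K K) (z : HahnSeries ℚ ℂ) (p : K[X][X])
    (q : ℚ) :
    (seriesEval (baseSeries z) (coeffDerivation (coeffDerivation δ) p)).coeff q =
      δ ((seriesEval (baseSeries z) p).coeff q) := by
  induction p using Polynomial.induction_on' with
  | add p p' hp hp' => simp only [map_add, HahnSeries.coeff_add, hp, hp']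
  | monomial m f =>
    rw [coeffDerivation_monomial]
    induction f using Polynomial.induction_on' with
    | add f f' hf hf' => simp only [map_add, HahnSeries.coeff_add, hf, hf']
    | monomial a c =>
      have key : ∀ c : K, (seriesEval (baseSeries z) (monomial m (monomial a c))).coeff q =
          c * algebraMap ℂ K ((polySeries (X ^ a) * z ^ m).coeff q) := by
        intro c
        have h : seriesEval (baseSeries z) (monomial m (monomial a c)) =
            HahnSeries.C c * baseSeries (polySeries (X ^ a) * z ^ m) := by
          have := RingHom.congr_fun (baseSeries_comp_polySeries (K := K)) (X ^ a)
          simp only [RingHom.comp_apply, coe_mapRingHom, Polynomial.map_pow, map_X] at this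
          have hC : polySeries (C c) = HahnSeries.C c := by simp [polySeries]
          rw [seriesEval_apply, map_monomial, eval_monomial, ← C_mul_X_pow_eq_monomial,
            RingHom.map_mul polySeries, RingHom.map_mul baseSeries, this,
            RingHom.map_pow baseSeries z, hC, mul_assoc]
        rw [h, HahnSeries.C_mul_eq_smul, HahnSeries.coeff_smul, coeff_baseSeries, smul_eq_mul]
      rw [coeffDerivation_monomial, key, key, Derivation.leibniz, Derivation.map_algebraMap,
        smul_zero, zero_add, smul_eq_mul, mul_comm]

lemma order_le_order_coeffDerivation (δ : Derivation ℂ K K) (z : HahnSeries ℚ ℂ) (p : K[X][X])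
    (h : seriesEval (baseSeries z) (coeffDerivation (coeffDerivation δ) p) ≠ 0) :
    (seriesEval (baseSeries z) p).order ≤
      (seriesEval (baseSeries z) (coeffDerivation (coeffDerivation δ) p)).order := by
  refine HahnSeries.order_le_of_coeff_ne_zero fun h0 => ?_
  have := HahnSeries.coeff_order_eq_zero.not.mpr h
  rw [coeff_seriesEval_coeffDerivation, h0, map_zero] at this
  exact this rfl

end BaseChange

/-! ### Orders at infinity along the branches -/

section Orders

variable {n : ℕ} {χ : ℂ[X][X]} {y : Fin n → HahnSeries ℚ ℂ}

/-- The difference of two series with distinct highest terms has no cancellation. -/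
lemma order_sub_of_highestTerm_ne {z w : HahnSeries ℚ ℂ} (hz : z ≠ 0) (hw : w ≠ 0)
    (h : highestTerm z ≠ highestTerm w) :
    HahnSeries.addVal ℚ ℂ (z - w) =
      ((-max (highestExponent z) (highestExponent w) : ℚ) : WithTop ℚ) := by
  simp only [highestExponent, max_neg_neg, neg_neg]
  rcases lt_trichotomy z.order w.order with h1 | h1 | h1
  · rw [AddValuation.map_sub_eq_of_lt_left, HahnSeries.addVal_apply_of_ne hz, min_eq_left h1.le]
    rw [HahnSeries.addVal_apply_of_ne hz, HahnSeries.addVal_apply_of_ne hw]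
    exact_mod_cast h1
  · rw [← h1, min_self]
    refine le_antisymm (HahnSeries.addVal_le_of_coeff_ne_zero ?_) (AddValuation.map_le_sub _ ?_ ?_)
    · rw [HahnSeries.coeff_sub, sub_ne_zero, ← HahnSeries.leadingCoeff_eq, h1, ← HahnSeries.leadingCoeff_eq]
      intro h2
      exact h (by rw [highestTerm, highestTerm, h1, h2])
    · rw [HahnSeries.addVal_apply_of_ne hz]
    · rw [HahnSeries.addVal_apply_of_ne hw, h1]
  · rw [AddValuation.map_sub_eq_of_lt_right, HahnSeries.addVal_apply_of_ne hw, min_eq_right h1.le]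
    rw [HahnSeries.addVal_apply_of_ne hz, HahnSeries.addVal_apply_of_ne hw]
    exact_mod_cast h1

/-- The order at infinity of `χ'` on the branch `y l`. -/
lemma addVal_eval_derivative (hy : ∀ l, y l ≠ 0)
    (hroots : χ.map toSeries = ∏ l, (X - C (y l)))
    (hdistinct : Function.Injective fun l => highestTerm (y l)) (l : Fin n) :
    HahnSeries.addVal ℚ ℂ (((derivative χ).map polySeries).eval (y l)) =
      ((highestExponent (y l) -
        ∑ k, max (highestExponent (y k)) (highestExponent (y l)) : ℚ) : WithTop ℚ) := by
  classical
  have h1 : ((derivative χ).map polySeries).eval (y l) =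
      ∏ k ∈ Finset.univ.erase l, (y l - y k) := by
    rw [← derivative_map, ← toSeries_eq_polySeries, hroots, ← Lagrange.nodal_eq,
      Lagrange.eval_nodal_derivative_eval_node_eq (Finset.mem_univ l), Lagrange.eval_nodal]
  have h2 : ∀ s : Finset (Fin n), l ∉ s → HahnSeries.addVal ℚ ℂ (∏ k ∈ s, (y l - y k)) =
      ((-∑ k ∈ s, max (highestExponent (y k)) (highestExponent (y l)) : ℚ) : WithTop ℚ) := by
    intro s
    induction s using Finset.induction_on with
    | empty => simp
    | insert k s hk ih =>
      intro hl
      rw [Finset.mem_insert, not_or] at hl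
      rw [Finset.prod_insert hk, Finset.sum_insert hk, AddValuation.map_mul, ih hl.2,
        order_sub_of_highestTerm_ne (hy l) (hy k) fun h => hl.1 (hdistinct h), ← WithTop.coe_add,
        max_comm, neg_add]
  rw [h1, h2 _ (Finset.notMem_erase l _), ← Finset.add_sum_erase _ _ (Finset.mem_univ l), max_self]
  congr 1
  ring

/-- The differentials attached to interior points vanish at infinity to an order exceeding `1`
in `u = 1 / x` along every branch. -/
lemma one_add_order_lt (hy : ∀ l, y l ≠ 0)
    (hroots : χ.map toSeries = ∏ l, (X - C (y l)))
    (hdistinct : Function.Injective fun l => highestTerm (y l)) (l : Fin n) {g : ℂ[X][X]}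
    (hg : g ∈ numerators χ) (hne : (g.map polySeries).eval (y l) ≠ 0) :
    1 + (((derivative χ).map polySeries).eval (y l)).order <
      ((g.map polySeries).eval (y l)).order := by
  have h1 := addVal_eval_derivative hy hroots hdistinct l
  have hne' : ((derivative χ).map polySeries).eval (y l) ≠ 0 := by
    intro h0
    rw [h0, AddValuation.map_zero] at h1
    exact WithTop.top_ne_coe h1
  rw [HahnSeries.addVal_apply_of_ne hne', WithTop.coe_eq_coe] at h1
  have h2 : ((1 + (((derivative χ).map polySeries).eval (y l)).order : ℚ) : WithTop ℚ) <
      HahnSeries.addVal ℚ ℂ ((g.map polySeries).eval (y l)) := by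
    rw [eval_eq_sum_range (p := g.map polySeries)]
    refine AddValuation.map_lt_sum (HahnSeries.addVal ℚ ℂ) ?_ fun m _ => ?_
    · exact WithTop.coe_ne_top
    rw [coeff_map, AddValuation.map_mul, AddValuation.map_pow, HahnSeries.addVal_apply_of_ne (hy l)]
    by_cases hm : g.coeff m = 0
    · simp only [hm, map_zero, AddValuation.map_zero, top_add]
      exact WithTop.coe_lt_top _
    rw [addVal_polySeries hm, ← WithTop.coe_nsmul, ← WithTop.coe_add, WithTop.coe_lt_coe, h1,
      nsmul_eq_mul]
    have h3 := add_mul_lt_of_mem_interiorPoints hy hroots (highestExponent (y l))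
      (hg _ m (leadingCoeff_ne_zero.mpr hm))
    simp only [Int.cast_add, Int.cast_natCast, Int.cast_one] at h3
    have h4 : highestExponent (y l) = -(y l).order := rfl
    rw [h4] at h3 ⊢
    linarith
  rw [HahnSeries.addVal_apply_of_ne hne, WithTop.coe_lt_coe] at h2
  exact h2

end Orders

/-! ### Abel's theorem -/

section Abel

variable {K : Type*} [Field K]

/-- The trace of `h / χ'` is a polynomial in `x`: the top coefficient of `h` modulo `χ`. -/
noncomputable def eulerTrace (χ h : K[X][X]) : K[X] := (h %ₘ χ).coeff (χ.natDegree - 1)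

/-- The value of the trace at `x` is a sum over the points of the curve above `x`. -/
lemma eval_eulerTrace [DecidableEq K] [IsAlgClosed K] {χ h : K[X][X]} (hm : χ.Monic) {x : K}
    (hsep : (χ.map (evalRingHom x)).Separable) :
    (eulerTrace χ h).eval x = ∑ z ∈ (χ.map (evalRingHom x)).roots.toFinset,
      evalEval x z h / evalEval x z (derivative χ) := by
  have h1 := coeff_modByMonic_eq_sum_roots (hm.map (evalRingHom x)) hsep
    (IsAlgClosed.splits _) (h.map (evalRingHom x))
  rw [← map_modByMonic _ hm, coeff_map, coe_evalRingHom, hm.natDegree_map] at h1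
  rw [eulerTrace, h1]
  simp only [map_evalRingHom_eval, derivative_map]

variable [Algebra ℂ K]

/-- A polynomial in `x, y` with constant coefficients, seen over the field `K`. -/
noncomputable def constPoly (K : Type*) [Field K] [Algebra ℂ K] : ℂ[X][X] →+* K[X][X] :=
  mapRingHom (mapRingHom (algebraMap ℂ K))

lemma constPoly_apply (p : ℂ[X][X]) :
    constPoly K p = p.map (mapRingHom (algebraMap ℂ K)) := rfl

/-- The trace of `g δθ b / χ'`, where `b` is the cofactor of `θ` in the resultant `r`, has degree
at most `deg r - 2`. -/
lemma natDegree_eulerTrace_lt {n : ℕ} {χ g : ℂ[X][X]} {y : Fin n → HahnSeries ℚ ℂ}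
    (hmonic : χ.Monic) (hdeg : χ.natDegree = n)
    (hy : ∀ l, y l ≠ 0) (hroots : χ.map toSeries = ∏ l, (X - C (y l)))
    (hdistinct : Function.Injective fun l => highestTerm (y l)) (hg : g ∈ numerators χ)
    (δ : Derivation ℂ K K) {θ a b : K[X][X]} {r : K[X]} (hr0 : r ≠ 0)
    (hr : constPoly K χ * a + θ * b = C r)
    (hne : eulerTrace (constPoly K χ)
      (constPoly K g * coeffDerivation (coeffDerivation δ) θ * b) ≠ 0) :
    (eulerTrace (constPoly K χ)
      (constPoly K g * coeffDerivation (coeffDerivation δ) θ * b)).natDegree + 1 <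
      r.natDegree := by
  set θ' := coeffDerivation (coeffDerivation δ) θ with hθ'
  set R := eulerTrace (constPoly K χ) (constPoly K g * θ' * b) with hR
  set Y : Fin n → HahnSeries ℚ K := fun l => baseSeries (y l) with hY
  have hχm : (constPoly K χ).Monic := hmonic.map _
  have hχdeg : (constPoly K χ).natDegree = n := by
    rw [constPoly_apply, hmonic.natDegree_map, hdeg]
  have hχ : (constPoly K χ).map polySeries = ∏ l, (X - C (Y l)) := by
    rw [constPoly_apply, map_map, ← baseSeries_comp_polySeries, ← map_map, ← toSeries_eq_polySeries,
      hroots, Polynomial.map_prod]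
    simp [hY]
  have hyinj : Function.Injective y := fun l k h => hdistinct (by simp only [h])
  have hYinj : Function.Injective Y := baseSeries.injective.comp hyinj
  have hsum : polySeries R = ∑ l, seriesEval (Y l) (constPoly K g * θ' * b) /
      seriesEval (Y l) (derivative (constPoly K χ)) := by
    have h1 := coeff_modByMonic_prod Finset.univ hYinj.injOn
      ((constPoly K g * θ' * b).map polySeries)
    rw [← hχ, ← map_modByMonic _ hχm, coeff_map, Finset.card_univ, Fintype.card_fin] at h1
    rw [hR, eulerTrace, hχdeg, h1]
    simp only [seriesEval_apply, derivative_map]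
  have hchi0 : ∀ l, seriesEval (Y l) (constPoly K χ) = 0 := by
    intro l
    rw [seriesEval_apply, hχ, eval_prod]
    exact Finset.prod_eq_zero (Finset.mem_univ l) (by simp)
  have hcof : ∀ l, seriesEval (Y l) θ * seriesEval (Y l) b = polySeries r := by
    intro l
    have := congrArg (seriesEval (Y l)) hr
    rw [map_add, map_mul, map_mul, hchi0, zero_mul, zero_add] at this
    rw [this, seriesEval_apply, map_C, eval_C]
  have hrS : (polySeries r : HahnSeries ℚ K) ≠ 0 :=
    (map_ne_zero_iff _ polySeries_injective).mpr hr0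
  have hterm : ∀ l ∈ Finset.univ, ((1 + -(r.natDegree : ℚ) : ℚ) : WithTop ℚ) <
      HahnSeries.addVal ℚ K (seriesEval (Y l) (constPoly K g * θ' * b) /
        seriesEval (Y l) (derivative (constPoly K χ))) := by
    intro l _
    set t := seriesEval (Y l) (constPoly K g * θ' * b) /
        seriesEval (Y l) (derivative (constPoly K χ)) with ht
    by_cases ht0 : t = 0
    · rw [ht0, AddValuation.map_zero]
      exact WithTop.coe_lt_top _
    obtain ⟨hnum, hden⟩ := div_ne_zero_iff.mp ht0
    have hmul : t * seriesEval (Y l) (derivative (constPoly K χ)) =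
        seriesEval (Y l) (constPoly K g) * seriesEval (Y l) θ' * seriesEval (Y l) b := by
      rw [ht, div_mul_cancel₀ _ hden, map_mul, map_mul]
    rw [map_mul, map_mul] at hnum
    have hg0 := left_ne_zero_of_mul (left_ne_zero_of_mul hnum)
    have hθ'0 := right_ne_zero_of_mul (left_ne_zero_of_mul hnum)
    have hb0 := right_ne_zero_of_mul hnum
    have hθ0 : seriesEval (Y l) θ ≠ 0 := left_ne_zero_of_mul ((hcof l).symm ▸ hrS)
    have o1 := congrArg HahnSeries.order hmul
    rw [HahnSeries.order_mul ht0 hden, HahnSeries.order_mul (mul_ne_zero hg0 hθ'0) hb0,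
      HahnSeries.order_mul hg0 hθ'0] at o1
    have o2 := congrArg HahnSeries.order (hcof l)
    rw [HahnSeries.order_mul hθ0 hb0] at o2
    have o3 : (polySeries r : HahnSeries ℚ K).order = -(r.natDegree : ℚ) := by
      have := addVal_polySeries hr0
      rwa [HahnSeries.addVal_apply_of_ne hrS, WithTop.coe_eq_coe] at this
    -- differentiating the parameters does not lower the order
    have o4 := order_le_order_coeffDerivation δ (y l) θ hθ'0
    have eg : seriesEval (Y l) (constPoly K g) = baseSeries ((g.map polySeries).eval (y l)) :=
      seriesEval_baseSeries _ _
    have eχ : seriesEval (Y l) (derivative (constPoly K χ)) =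
        baseSeries (((derivative χ).map polySeries).eval (y l)) := by
      rw [constPoly_apply, derivative_map]
      exact seriesEval_baseSeries _ _
    have o5 := one_add_order_lt hy hroots hdistinct l hg fun h0 => hg0 (by rw [eg, h0, map_zero])
    rw [eg, eχ, order_baseSeries, order_baseSeries] at o1
    rw [HahnSeries.addVal_apply_of_ne ht0, WithTop.coe_lt_coe]
    linarith
  have h1 := AddValuation.map_lt_sum (HahnSeries.addVal ℚ K) WithTop.coe_ne_top hterm
  rw [← hsum, addVal_polySeries hne, WithTop.coe_lt_coe] at h1
  have h2 : (R.natDegree : ℚ) + 1 < r.natDegree := by linarith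
  exact_mod_cast h2

/-- Abel's theorem for a derivation `δ` in the parameters: up to sign, the sum is that of `R / r'`
over the roots of `r`, with `deg R ≤ deg r - 2`. -/
theorem sum_residues_eq_zero [DecidableEq K] [IsAlgClosed K] {n : ℕ} {χ g : ℂ[X][X]}
    {y : Fin n → HahnSeries ℚ ℂ} (hmonic : χ.Monic) (hdeg : χ.natDegree = n)
    (hy : ∀ l, y l ≠ 0) (hroots : χ.map toSeries = ∏ l, (X - C (y l)))
    (hdistinct : Function.Injective fun l => highestTerm (y l)) (hg : g ∈ numerators χ)
    (δ : Derivation ℂ K K) {θ a b : K[X][X]} {r : K[X]} (hsep : r.Separable)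
    (hr : constPoly K χ * a + θ * b = C r)
    (hχsep : ∀ x, r.IsRoot x → ((constPoly K χ).map (evalRingHom x)).Separable) :
    ∑ x ∈ r.roots.toFinset,
      ∑ z ∈ ((constPoly K χ).map (evalRingHom x)).roots.toFinset.filter
        (fun z => evalEval x z θ = 0),
        evalEval x z (constPoly K g) / evalEval x z (derivative (constPoly K χ)) * δ x = 0 := by
  set θ' := coeffDerivation (coeffDerivation δ) θ with hθ'
  set R := eulerTrace (constPoly K χ) (constPoly K g * θ' * b) with hR
  have hχm : (constPoly K χ).Monic := hmonic.map _
  have hzero : ∑ x ∈ r.roots.toFinset, R.eval x / (derivative r).eval x = 0 := by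
    by_cases hR0 : R = 0
    · simp [hR0]
    · exact sum_eval_div_derivative_eq_zero hsep (IsAlgClosed.splits r)
        (natDegree_eulerTrace_lt hmonic hdeg hy hroots hdistinct hg δ hsep.ne_zero hr hR0)
  refine neg_eq_zero.mp (Eq.trans ?_ hzero)
  rw [← Finset.sum_neg_distrib]
  refine Finset.sum_congr rfl fun x hx => ?_
  have hx0 : r.IsRoot x := isRoot_of_mem_roots (Multiset.mem_toFinset.mp hx)
  have hr' : (derivative r).eval x ≠ 0 := hsep.eval₂_derivative_ne_zero (RingHom.id K) hx0
  rw [hR, eval_eulerTrace hχm (hχsep x hx0), Finset.sum_div, Finset.sum_filter,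
    ← Finset.sum_neg_distrib]
  refine Finset.sum_congr rfl fun z hz => ?_
  have hz0 : evalEval x z (constPoly K χ) = 0 := by
    rw [← map_evalRingHom_eval]
    exact isRoot_of_mem_roots (Multiset.mem_toFinset.mp hz)
  rw [evalEval_mul, evalEval_mul]
  split_ifs with hθ0
  · have h1 := evalEval_mul_evalEval_coeffDerivation δ (coeffDerivation_map_eq_zero δ χ) hr hz0 hθ0
    rw [mul_assoc, mul_comm (evalEval x z θ'), h1]
    field_simp
  · -- the cofactor vanishes at the points above `x` which are not zeros of `θ`
    have h1 := congrArg (evalEval x z) hr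
    rw [evalEval_add, evalEval_mul, evalEval_mul, hz0, zero_mul, zero_add, evalEval_C,
      hx0.eq_zero] at h1
    rw [(mul_eq_zero.mp h1).resolve_left hθ0]
    simp

end Abel

/-! ### Specialization of the curve at a transcendental abscissa -/

/-- The discriminant of `χ` is a nonzero polynomial in `x`, and it is a combination of `χ` and
`χ'`. -/
lemma exists_mul_add_mul_derivative {χ : ℂ[X][X]} (hirr : Irreducible χ) (hmonic : χ.Monic)
    (hdeg : 0 < χ.natDegree) :
    ∃ a b : ℂ[X][X], ∃ d : ℂ[X], d ≠ 0 ∧ χ * a + derivative χ * b = C d := by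
  obtain ⟨a, b, -, -, h⟩ := exists_mul_add_mul_eq_C_resultant χ (derivative χ)
    (m := χ.natDegree) (n := (derivative χ).natDegree) le_rfl le_rfl (Or.inl hdeg.ne')
  refine ⟨a, b, _, ?_, h⟩
  have hinj : Function.Injective (algebraMap ℂ[X] (FractionRing ℂ[X])) :=
    IsFractionRing.injective _ _
  rw [← map_ne_zero_iff _ hinj, ← resultant_map_map,
    ← natDegree_map_eq_of_injective hinj χ, ← natDegree_map_eq_of_injective hinj (derivative χ),
    ← derivative_map, Ne, resultant_eq_zero_iff]
  rintro ⟨-, hcop⟩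
  exact hcop ((hmonic.irreducible_iff_irreducible_map_fraction_map
    (K := FractionRing ℂ[X])).mp hirr).separable

section Transcendental

variable {K : Type*} [Field K] [Algebra ℂ K]

lemma exists_eq_algebraMap_of_aeval_eq_zero {d : ℂ[X]} (hd : d ≠ 0) {x : K}
    (hx : aeval x d = 0) : ∃ c : ℂ, x = algebraMap ℂ K c := by
  have halg : IsAlgebraic ℂ x := ⟨d, hd, hx⟩
  have hint : IsIntegral ℂ x := halg.isIntegral
  obtain ⟨c, hc⟩ := minpoly.mem_range_of_degree_eq_one ℂ x
    (IsAlgClosed.degree_eq_one_of_irreducible ℂ (minpoly.irreducible hint))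
  exact ⟨c, hc.symm⟩

/-- Above an abscissa that is not constant, the curve is unramified. -/
lemma separable_map_evalRingHom {χ : ℂ[X][X]} (hirr : Irreducible χ) (hmonic : χ.Monic)
    (hdeg : 0 < χ.natDegree) {x : K} (hx : ∀ c : ℂ, x ≠ algebraMap ℂ K c) :
    ((constPoly K χ).map (evalRingHom x)).Separable := by
  obtain ⟨a, b, d, hd, h⟩ := exists_mul_add_mul_derivative hirr hmonic hdeg
  have hdx : (d.map (algebraMap ℂ K)).eval x ≠ 0 := by
    intro h0
    rw [eval_map_algebraMap] at h0
    obtain ⟨c, hc⟩ := exists_eq_algebraMap_of_aeval_eq_zero hd h0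
    exact hx c hc
  set φ : ℂ[X][X] →+* K[X] := (mapRingHom (evalRingHom x)).comp (constPoly K) with hφ
  have h1 := congrArg φ h
  rw [map_add, map_mul, map_mul] at h1
  have e1 : φ χ = (constPoly K χ).map (evalRingHom x) := rfl
  have e2 : φ (derivative χ) = derivative (φ χ) := by
    rw [e1, constPoly_apply, derivative_map, derivative_map]
    rfl
  have e3 : φ (C d) = C ((d.map (algebraMap ℂ K)).eval x) := by
    simp [hφ, constPoly_apply]
  rw [e2, e3] at h1
  rw [← e1]
  refine ⟨C ((d.map (algebraMap ℂ K)).eval x)⁻¹ * φ a,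
    C ((d.map (algebraMap ℂ K)).eval x)⁻¹ * φ b, ?_⟩
  have h2 : C ((d.map (algebraMap ℂ K)).eval x)⁻¹ * C ((d.map (algebraMap ℂ K)).eval x) = 1 := by
    rw [← C_mul, inv_mul_cancel₀ hdx, C_1]
  rw [← h2, ← h1]
  ring

end Transcendental

lemma aevalAeval_eq_evalEval_map {R A : Type*} [CommRing R] [CommRing A] [Algebra R A] (x z : A)
    (p : R[X][X]) :
    aevalAeval x z p = evalEval x z (p.map (mapRingHom (algebraMap R A))) := by
  have h : (aevalAeval x z : R[X][X] →ₐ[R] A).toRingHom =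
      (evalEvalRingHom x z).comp (mapRingHom (mapRingHom (algebraMap R A))) := by
    refine ringHom_ext' (ringHom_ext (fun c => ?_) ?_) ?_ <;> simp
  exact RingHom.congr_fun h p

/-! ### Abel sums over the moving solutions -/

section Moving

variable {s : ℕ} {n : ℕ} {χ : ℂ[X][X]} {θ : (Params s)[X][X]} {F₀ : ℂ[X]} {F : (Params s)[X]}

/-- The common zeros of `χ` and `θ`. -/
def commonZeros (χ : ℂ[X][X]) (θ : (Params s)[X][X]) : Set (AlgFun s × AlgFun s) :=
  {p | aevalAeval p.1 p.2 χ = 0 ∧ aevalAeval p.1 p.2 θ = 0}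

lemma movingSolutions_subset : movingSolutions χ θ ⊆ commonZeros χ θ :=
  fun _ hp => ⟨hp.1, hp.2.1⟩

/-- The polynomial `θ` over the field of algebraic functions of the parameters. -/
noncomputable def overAlgFun (θ : (Params s)[X][X]) : (AlgFun s)[X][X] :=
  θ.map (mapRingHom (algebraMap (Params s) (AlgFun s)))

/-- The resultant over the field of algebraic functions of the parameters. -/
noncomputable def elimAlgFun (χ : ℂ[X][X]) (θ : (Params s)[X][X]) : (AlgFun s)[X] :=
  (elim χ θ).map (algebraMap (Params s) (AlgFun s))

lemma exists_mul_add_mul_eq_C_elimAlgFun (hmonic : χ.Monic) (hdeg : 0 < χ.natDegree) :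
    ∃ a b : (AlgFun s)[X][X],
      constPoly (AlgFun s) χ * a + overAlgFun θ * b = C (elimAlgFun χ θ) := by
  set χP : (Params s)[X][X] := χ.map (mapRingHom MvPolynomial.C) with hχP
  obtain ⟨a, b, -, -, h⟩ := exists_mul_add_mul_eq_C_resultant χP θ
    (m := χP.natDegree) (n := θ.natDegree) le_rfl le_rfl
    (Or.inl (by rw [hχP, hmonic.natDegree_map]; exact hdeg.ne'))
  have h1 := congrArg (mapRingHom (mapRingHom (algebraMap (Params s) (AlgFun s)))) h
  rw [map_add, map_mul, map_mul] at h1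
  have e1 : mapRingHom (mapRingHom (algebraMap (Params s) (AlgFun s))) χP =
      constPoly (AlgFun s) χ := by
    rw [hχP, coe_mapRingHom, map_map, constPoly_apply]
    congr 1
    refine ringHom_ext (fun c => ?_) (by simp)
    simp only [RingHom.comp_apply, coe_mapRingHom, map_C]
    rw [← MvPolynomial.algebraMap_eq, ← IsScalarTower.algebraMap_apply]
  rw [e1] at h1
  refine ⟨_, _, h1.trans ?_⟩
  rw [coe_mapRingHom, map_C]
  rfl

lemma separable_elimAlgFun (hsplit : IsRootSplitting (elim χ θ) F₀ F) (hF₀ : IsUnit F₀)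
    (hF : (F.map (algebraMap (Params s) (ParamField s))).Separable) :
    (elimAlgFun χ θ).Separable := by
  have h1 : (F.map (algebraMap (Params s) (AlgFun s))).Separable := by
    rw [IsScalarTower.algebraMap_eq (Params s) (ParamField s) (AlgFun s), ← map_map]
    exact hF.map
  rw [elimAlgFun, hsplit.eq_mul, Polynomial.map_mul, map_map]
  exact Separable.unit_mul (hF₀.map (mapRingHom _)) h1

lemma ne_algebraMap_of_isRoot (hsplit : IsRootSplitting (elim χ θ) F₀ F) (hF₀ : IsUnit F₀)
    {x : AlgFun s} (hx : (elimAlgFun χ θ).IsRoot x) (c : ℂ) : x ≠ algebraMap ℂ (AlgFun s) c := by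
  rintro rfl
  have hc : algebraMap ℂ (AlgFun s) c = algebraMap (Params s) (AlgFun s) (MvPolynomial.C c) := by
    rw [← MvPolynomial.algebraMap_eq, ← IsScalarTower.algebraMap_apply]
  have hinj : Function.Injective (algebraMap (Params s) (AlgFun s)) := by
    rw [IsScalarTower.algebraMap_eq (Params s) (ParamField s) (AlgFun s)]
    exact (algebraMap (ParamField s) (AlgFun s)).injective.comp (IsFractionRing.injective _ _)
  rw [IsRoot, elimAlgFun, hc, eval_map_apply, map_eq_zero_iff _ hinj, hsplit.eq_mul, eval_mul,
    eval_map_apply] at hx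
  have h0 : eval c F₀ ≠ 0 := (hF₀.map (evalRingHom c)).ne_zero
  refine hsplit.eval_ne_zero c ((mul_eq_zero.mp hx).resolve_left ?_)
  rwa [map_eq_zero_iff _ (MvPolynomial.C_injective _ _)]

lemma mem_commonZeros_iff {p : AlgFun s × AlgFun s} : p ∈ commonZeros χ θ ↔
    evalEval p.1 p.2 (constPoly (AlgFun s) χ) = 0 ∧ evalEval p.1 p.2 (overAlgFun θ) = 0 := by
  rw [commonZeros, Set.mem_ofPred_eq, aevalAeval_eq_evalEval_map, aevalAeval_eq_evalEval_map]
  rfl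

lemma isRoot_elimAlgFun (hmonic : χ.Monic) (hdeg : 0 < χ.natDegree) {p : AlgFun s × AlgFun s}
    (hp : p ∈ commonZeros χ θ) : (elimAlgFun χ θ).IsRoot p.1 := by
  obtain ⟨a, b, h⟩ := exists_mul_add_mul_eq_C_elimAlgFun (θ := θ) hmonic hdeg
  rw [mem_commonZeros_iff] at hp
  have h1 := congrArg (evalEval p.1 p.2) h
  rw [evalEval_add, evalEval_mul, evalEval_mul, hp.1, hp.2, zero_mul, zero_mul, add_zero,
    evalEval_C] at h1
  exact h1.symm

/-- The common zeros, listed by abscissa. -/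
lemma mem_commonZeros_iff_roots [DecidableEq (AlgFun s)] (hmonic : χ.Monic)
    (hdeg : 0 < χ.natDegree) (hr : elimAlgFun χ θ ≠ 0) {p : AlgFun s × AlgFun s} :
    p ∈ commonZeros χ θ ↔ p.1 ∈ (elimAlgFun χ θ).roots.toFinset ∧
      p.2 ∈ ((constPoly (AlgFun s) χ).map (evalRingHom p.1)).roots.toFinset.filter
        (fun z => evalEval p.1 z (overAlgFun θ) = 0) := by
  have hχm : ((constPoly (AlgFun s) χ).map (evalRingHom p.1)).Monic := (hmonic.map _).map _
  rw [Finset.mem_filter, Multiset.mem_toFinset, Multiset.mem_toFinset, mem_roots hr,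
    mem_roots hχm.ne_zero, IsRoot.def (p := Polynomial.map _ _), map_evalRingHom_eval,
    ← mem_commonZeros_iff, iff_and_self]
  exact isRoot_elimAlgFun hmonic hdeg

lemma finite_commonZeros (hmonic : χ.Monic) (hdeg : 0 < χ.natDegree)
    (hr : elimAlgFun χ θ ≠ 0) : (commonZeros χ θ).Finite := by
  classical
  refine ((elimAlgFun χ θ).roots.toFinset.finite_toSet.biUnion fun x _ =>
    ((((constPoly (AlgFun s) χ).map (evalRingHom x)).roots.toFinset.filter
      (fun z => evalEval x z (overAlgFun θ) = 0)).image (Prod.mk x)).finite_toSet).subset ?_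
  intro p hp
  rw [mem_commonZeros_iff_roots hmonic hdeg hr] at hp
  simp only [Set.mem_iUnion]
  exact ⟨p.1, hp.1, Finset.mem_coe.mpr (Finset.mem_image.mpr ⟨p.2, hp.2, rfl⟩)⟩

lemma aevalAeval_derivative_ne_zero {K : Type*} [Field K] [Algebra ℂ K] {x z : K}
    (hsep : ((constPoly K χ).map (evalRingHom x)).Separable) (hz : aevalAeval x z χ = 0) :
    aevalAeval x z (derivative χ) ≠ 0 := by
  rw [aevalAeval_eq_evalEval_map, ← derivative_map, ← map_evalRingHom_eval, ← derivative_map]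
  rw [aevalAeval_eq_evalEval_map, ← map_evalRingHom_eval] at hz
  exact hsep.eval₂_derivative_ne_zero (RingHom.id K) hz

/-- Abel's theorem: the differential `dv` vanishes. The solutions with `dx = 0` contribute nothing,
so the sum may be taken over all common zeros, and it suffices to test it against derivations. -/
theorem dv_eq_zero {y : Fin n → HahnSeries ℚ ℂ} (hirr : Irreducible χ) (hmonic : χ.Monic)
    (hdeg : χ.natDegree = n) (hn : 0 < n) (hy : ∀ l, y l ≠ 0)
    (hroots : χ.map toSeries = ∏ l, (X - C (y l)))
    (hdistinct : Function.Injective fun l => highestTerm (y l)) {g : ℂ[X][X]}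
    (hg : g ∈ numerators χ) (hsplit : IsRootSplitting (elim χ θ) F₀ F) (hF₀ : IsUnit F₀)
    (hF : (F.map (algebraMap (Params s) (ParamField s))).Separable) : dv χ θ g = 0 := by
  classical
  have hdeg' : 0 < χ.natDegree := hdeg ▸ hn
  have hsep := separable_elimAlgFun hsplit hF₀ hF
  have hfin := finite_commonZeros (θ := θ) hmonic hdeg' hsep.ne_zero
  have hsum : dv χ θ g = ∑ p ∈ hfin.toFinset,
      ratValue χ g p.1 p.2 • KaehlerDifferential.D ℂ (AlgFun s) p.1 := by
    refine finsum_mem_eq_sum_of_inter_support_eq _ ?_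
    ext p
    simp only [Set.mem_inter_iff, Set.Finite.coe_toFinset, Function.mem_support]
    refine and_congr_left fun hp => ⟨fun h => movingSolutions_subset h, fun h => ?_⟩
    exact ⟨h.1, h.2, right_ne_zero_of_smul hp⟩
  rw [← Module.forall_dual_apply_eq_zero_iff (AlgFun s)]
  intro φ
  obtain ⟨a, b, hab⟩ := exists_mul_add_mul_eq_C_elimAlgFun (θ := θ) hmonic hdeg'
  have h := sum_residues_eq_zero hmonic hdeg hy hroots hdistinct hg
    (φ.compDer (KaehlerDifferential.D ℂ (AlgFun s))) hsep hab fun x hx =>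
      separable_map_evalRingHom hirr hmonic hdeg' (ne_algebraMap_of_isRoot hsplit hF₀ hx)
  rw [hsum, map_sum, Finset.sum_finset_product hfin.toFinset (elimAlgFun χ θ).roots.toFinset
    (fun x => ((constPoly (AlgFun s) χ).map (evalRingHom x)).roots.toFinset.filter
      (fun z => evalEval x z (overAlgFun θ) = 0)) fun p => by
    rw [Set.Finite.mem_toFinset]
    exact mem_commonZeros_iff_roots hmonic hdeg' hsep.ne_zero]
  refine Eq.trans ?_ h
  refine Finset.sum_congr rfl fun x _ => Finset.sum_congr rfl fun z _ => ?_
  rw [map_smul, ratValue, aevalAeval_eq_evalEval_map, aevalAeval_eq_evalEval_map,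
    ← derivative_map]
  rfl

/-- The derivatives of Abel's sum are the values of `dv` on the partial derivations. -/
lemma partials_sum_eq_zero {E : Type*} [Field E] [Algebra ℂ E] [Algebra (AlgFun s) E]
    [IsScalarTower ℂ (AlgFun s) E] (D : PartialDerivatives s E)
    (v : AlgFun s × AlgFun s → E) {g : ℂ[X][X]} (hfin : (movingSolutions χ θ).Finite)
    (hv : AreIntegrals D χ θ g v) (hdv : dv χ θ g = 0) (j : Fin s) :
    D.partials j (∑ᶠ p ∈ movingSolutions χ θ, v p) = 0 := by
  set ℓ := ((D.partials j).compAlgebraMap (AlgFun s)).liftKaehlerDifferential with hℓ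
  have h := congrArg ℓ hdv
  rw [dv, finsum_mem_eq_finite_toFinset_sum _ hfin, map_sum, map_zero] at h
  rw [finsum_mem_eq_finite_toFinset_sum _ hfin, map_sum, ← h]
  refine Finset.sum_congr rfl fun p hp => ?_
  rw [hv p (hfin.mem_toFinset.mp hp) j, map_smul, hℓ, Derivation.liftKaehlerDifferential_comp_D,
    Algebra.smul_def]
  rfl

end Moving

end AbelNewton

theorem proposition5p3 (n : ℕ) (χ : ℂ[X][X]) [Fact (Irreducible χ)]
    (hmonic : χ.Monic) (hdeg : χ.natDegree = n)
    (hconst : (χ.coeff 0).coeff 0 ≠ 0)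
    -- the solutions of `χ(x, y) = 0` in Puiseux series in `1 / x`
    (y : Fin n → HahnSeries ℚ ℂ) (hpuiseux : ∀ l, AbelNewton.IsPuiseux (y l))
    (hroots : χ.map AbelNewton.toSeries = ∏ l, (X - C (y l)))
    (hdistinct : Function.Injective fun l => AbelNewton.highestTerm (y l))
    (horder : Antitone fun l => AbelNewton.highestExponent (y l)) :
    -- (1)
    (∀ (s : ℕ) (θ : (AbelNewton.Params s)[X][X]) (F₀ : ℂ[X]) (F : (AbelNewton.Params s)[X]),
      θ.natDegree < n →
      AbelNewton.IsRootSplitting (AbelNewton.elim χ θ) F₀ F →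
      IsUnit F₀ →
      (F.map (algebraMap (AbelNewton.Params s) (AbelNewton.ParamField s))).Separable →
      (AbelNewton.movingSolutions χ θ).Finite ∧
      (∀ p ∈ AbelNewton.movingSolutions χ θ, aevalAeval p.1 p.2 (derivative χ) ≠ 0) ∧
      ∀ g ∈ AbelNewton.numerators χ,
        AbelNewton.dv χ θ g = 0 ∧
        ∀ (E : Type*) [Field E] [Algebra ℂ E] [Algebra (AbelNewton.AlgFun s) E]
          [IsScalarTower ℂ (AbelNewton.AlgFun s) E] (D : AbelNewton.PartialDerivatives s E)
          (v : AbelNewton.AlgFun s × AbelNewton.AlgFun s → E),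
          AbelNewton.AreIntegrals D χ θ g v →
          ∀ j, D.partials j (∑ᶠ p ∈ AbelNewton.movingSolutions χ θ, v p) = 0) ∧
    -- (2)
    (∀ m : ℕ, m + 2 ≤ n →
      ((AbelNewton.tauSet χ m).Nonempty →
        IsGreatest (AbelNewton.tauSet χ m) (AbelNewton.tau χ m)) ∧
      AbelNewton.tau χ m =
        ⌈∑ l ∈ Finset.univ.filter (fun l : Fin n => (l : ℕ) < n - m - 1),
          AbelNewton.highestExponent (y l)⌉ - 2) ∧
    -- (3)
    (AbelNewton.interiorPoints χ).Finite ∧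
    FiniteDimensional ℂ (AbelNewton.differentials χ) ∧
    Module.finrank ℂ (AbelNewton.differentials χ) = (AbelNewton.interiorPoints χ).ncard ∧
    ((AbelNewton.interiorPoints χ).ncard : ℤ) =
      ∑ m ∈ Finset.range (n - 1), (AbelNewton.tau χ m + 1) := by

  have hirr : Irreducible χ := Fact.out
  have hy := AbelNewton.root_ne_zero hconst hroots
  have hn : 0 < n := by
    by_contra h0
    -- a monic polynomial of degree `0` is a unit
    have h1 : χ = 1 := hmonic.natDegree_eq_zero.mp (by omega)
    exact hirr.not_isUnit (h1 ▸ isUnit_one)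
  have hdeg' : 0 < χ.natDegree := hdeg ▸ hn
  have hfin : (AbelNewton.interiorPoints χ).Finite := by
    rw [AbelNewton.interiorPoints_eq hirr hmonic hdeg hconst hroots horder]
    exact Finset.finite_toSet _
  refine ⟨fun s θ F₀ F _ hsplit hF₀ hF => ?_, fun m hm => ?_, hfin,
    AbelNewton.finiteDimensional_differentials hfin,
    AbelNewton.finrank_differentials hmonic hdeg' hfin,
    AbelNewton.ncard_interiorPoints hirr hmonic hdeg hconst hroots horder⟩
  · have hsep := AbelNewton.separable_elimAlgFun hsplit hF₀ hF
    have hmov : (AbelNewton.movingSolutions χ θ).Finite :=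
      (AbelNewton.finite_commonZeros hmonic hdeg' hsep.ne_zero).subset
        AbelNewton.movingSolutions_subset
    refine ⟨hmov, fun p hp => ?_, fun g hg => ?_⟩
    · have hroot := AbelNewton.isRoot_elimAlgFun hmonic hdeg'
        (AbelNewton.movingSolutions_subset hp)
      exact AbelNewton.aevalAeval_derivative_ne_zero
        (AbelNewton.separable_map_evalRingHom hirr hmonic hdeg'
          (AbelNewton.ne_algebraMap_of_isRoot hsplit hF₀ hroot)) hp.1
    · have hdv := AbelNewton.dv_eq_zero hirr hmonic hdeg hn hy hroots hdistinct hg hsplit hF₀ hF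
      exact ⟨hdv, fun E _ _ _ _ D v hv j =>
        AbelNewton.partials_sum_eq_zero D v hmov hv hdv j⟩
  · have htau := AbelNewton.tau_eq hirr hmonic hdeg hconst hroots horder hm
    refine ⟨fun hne => ?_, htau⟩
    rw [htau]
    exact AbelNewton.isGreatest_tauSet hmonic hdeg hconst hroots horder hm hne
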